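/- Let $R$ be a $3$-dimensional (Noetherian) Cohen–Macaulay local ring in which $2$ is a unit, let $x,y,z$ be a system of parameters of $R$, and let $\alpha=1$, $\alpha'=2$ and $\beta,\gamma,\beta',\gamma'$ be positive integers with $2\beta\le\beta'$ and $2\gamma\le\gamma'$. Let $I$ be the ideal generated by the maximal minors of $$\begin{pmatrix} x^{\alpha} & y^{\beta} & z^{\gamma}\\ y^{\beta'} & z^{\gamma'} & x^{\alpha'}\end{pmatrix},$$ let $Q=(x^{\min\{\alpha,\alpha'\}},y^{\min\{\beta,\beta'\}},z^{\min\{\gamma,\gamma'\}})R=(x,y^\beta,z^\gamma)R$, and let $I^{(3)}=\bigcap_{\mathfrak p\in\operatorname{Min}(R/I)}(I^3R_{\mathfrak p}\cap R)$ be the third symbolic power of $I$. Notation. Let $S_d$ be the degree $d$ part of $S=R[A,B,C]$; for $h\in S_2$ write $[h]=(h,0)$ and $\langle h\rangle=(0,h)$ in $S_2\oplus S_2$. Put $f=xA+y^\beta B+z^\gamma C$, $g=y^{\beta'}A+z^{\gamma'}B+x^{2}C$. For $M\in\{A,B,C\}$ put $$v^1_{(1,M)}=\langle AM\rangle-x[CM],\quad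 v^1_{(2,M)}=\langle BM\rangle-y^{\beta'-\beta}[AM],\quad v^1_{(3,M)}=\langle CM\rangle-z^{\gamma'-\gamma}[BM].$$ Let $K_\bullet$ be the Koszul complex of $x_1=x,\ x_2=y^\beta,\ x_3=z^\gamma$, with basis $e_1,e_2,e_3$ of $K_1$, with $\check e_1=e_2\wedge e_3$, $\check e_2=e_1\wedge e_3$, $\check e_3=e_1\wedge e_2$, and with $\partial_2(e_s\wedge e_t)=x_se_t-x_te_s$. Let $$\varphi:K_2\otimes S_1\to(K_1\otimes S_1)\oplus(S_2\oplus S_2),\qquad \check e_i\otimes M\mapsto\bigl(\partial_2(\check e_i)\otimes M,\ (-1)^i v^1_{(i,M)}\bigr).$$ Let $F$ be the submodule of the target generated by the elements $[i,M]=(e_i\otimes M,0)$ and $\langle[N]\rangle=(0,[N])$, for $i\in\{1,2,3\}$, $M\in\{A,B,C\}$ and $N$ a monomial of degree $2$. Let $$w_{1B}=-\check e_1\otimes B-\check e_2\otimes A,\quad w_{1C}=-\check e_1\otimes C+\check e_3\otimes A,\quad w_{2C}=\check e_2\otimes C+\check e_3\otimes B,$$ and let $v_{(j,\lambda)}\in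 F$, for $j\in\{1,2,3\}$ and $\lambda\in\{1B,1C,2C\}$, be the nine elements $$\begin{aligned} v_{(1,1B)}&=-[3,A]-\langle[BC]\rangle, & v_{(2,1B)}&=-[3,B]+y^{\beta'-2\beta}\langle[A^2]\rangle, & v_{(3,1B)}&=[2,B]+[1,A],\\ v_{(1,1C)}&=[2,A]-\langle[C^2]\rangle, & v_{(2,1C)}&=-[3,C]-[1,A], & v_{(3,1C)}&=[2,C]+z^{\gamma'-2\gamma}\langle[AB]\rangle,\\ v_{(1,2C)}&=[3,C]+[2,B], & v_{(2,2C)}&=-[1,B]-y^{\beta'-2\beta}\langle[AC]\rangle, & v_{(3,2C)}&=-[1,C]+z^{\gamma'-2\gamma}\langle[B^2]\rangle. \end{aligned}$$ Then: 1. One has $(-gM,fM)=x\,v^1_{(1,M)}+y^\beta v^1_{(2,M)}+z^\gamma v^1_{(3,M)}$ for all $M\in\{A,B,C\}$ and $\varphi(w_\lambda)=x\,v_{(1,\lambda)}+y^\beta v_{(2,\lambda)}+z^\gamma v_{(3,\lambda)}$ for all $\lambda\in\{1B,1C,2C\}$; and the nine elements $v_{(j,\lambda)}$ are part of a free $R$-basis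 of $F$, that is, there is a subset $U\subseteq F$ such that the $v_{(j,\lambda)}$ together with $U$ form a free basis of $F$. 2. $\operatorname{depth} R/(I^3:_RQ^2)>0$. 3. $I^{(3)}=I^3:_RQ^2$. 4. $\ell_R(I^{(3)}/I^3)=6\cdot\ell_R(R/Q)$. -/

import Mathlib

open IsLocalRing

noncomputable section

/-- The depth of a module over a local ring: the supremum of the lengths of the `M`-regular
sequences contained in the maximal ideal (used for nonzero finitely generated modules). -/
def localDepth (R : Type*) [CommRing R] [IsLocalRing R] (M : Type*) [AddCommGroup M]
    [Module R M] : ℕ∞ :=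
  ⨆ rs : {rs : List R // RingTheory.Sequence.IsRegular M rs ∧ ∀ r ∈ rs, r ∈ maximalIdeal R},
    (rs.1.length : ℕ∞)

/-- A Noetherian local ring is Cohen-Macaulay when its depth equals its Krull dimension. -/
def IsCohenMacaulayLocal (R : Type*) [CommRing R] [IsLocalRing R] : Prop :=
  IsNoetherianRing R ∧ (localDepth R R : WithBot ℕ∞) = ringKrullDim R

/-- A system of parameters: `dim R` elements generating an ideal primary to the maximal ideal. -/
def IsSystemOfParameters {R : Type*} [CommRing R] [IsLocalRing R] {d : ℕ} (s : Fin d → R) :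
    Prop :=
  ringKrullDim R = d ∧ (Ideal.span (Set.range s)).radical = maximalIdeal R

/-- The `n`-th symbolic power: the intersection, over the minimal primes `p` of `R / I`,
of the contractions to `R` of `I ^ n R_p`. -/
def symbolicPower {R : Type*} [CommRing R] (I : Ideal R) (n : ℕ) : Ideal R :=
  ⨅ p : I.minimalPrimes,
    haveI : p.1.IsPrime := p.2.1.1
    ((I ^ n).map (algebraMap R (Localization.AtPrime p.1))).comap
      (algebraMap R (Localization.AtPrime p.1))

/-- The ideal generated by the maximal minors of an `m × n` matrix (`m ≤ n`). -/
def maximalMinorsIdeal {R : Type*} [CommRing R] {m n : ℕ} (A : Matrix (Fin m) (Fin n) R) :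
    Ideal R :=
  Ideal.span (Set.range fun e : Fin m ↪o Fin n => (A.submatrix id e).det)

namespace StarTransform

variable {R : Type*} [CommRing R]

/-- `Admissible v T` : the part of the family `v` indexed by `T` can be completed, by some
subset `U`, to a free basis of the module. -/
def Admissible {F ι : Type*} [AddCommGroup F] [Module R F] (v : ι → F) (T : Set ι) : Prop :=
  ∃ (U : Set F) (b : Module.Basis (T ⊕ U) R F),
    (∀ t : T, b (Sum.inl t) = v t) ∧ ∀ u : U, b (Sum.inr u) = u

/-- With `K` the Koszul complex of `ξ 0, ξ 1, ξ 2` and `F₃` free with basis `w` indexed by `Λ`,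
the modules `K₁ ⊗ F₃` and `K₂ ⊗ F₃` are both written as `Fin 3 × Λ → R`, through the bases
`e i ⊗ w l` and `ě i ⊗ w l`, where `ě i = e s ∧ e t` with `s < t` and `{i, s, t} = {0, 1, 2}`.
For a family `v` in `F₂` this is the map
`K₂ ⊗ F₃ → (K₁ ⊗ F₃) ⊕ F₂`, `ě i ⊗ w l ↦ (∂₂ (ě i) ⊗ w l, (-1) ^ (i + 1) • v (i, l))`, where
`∂₂ (e s ∧ e t) = ξ s • e t - ξ t • e s`.
(Indices start at `0`; the sign is `(-1) ^ i` when they start at `1`.) -/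
def phi3 (ξ : Fin 3 → R) {Λ F₂ : Type*} [Fintype Λ] [DecidableEq Λ] [AddCommGroup F₂]
    [Module R F₂] (v : Fin 3 × Λ → F₂) : (Fin 3 × Λ → R) →ₗ[R] (Fin 3 × Λ → R) × F₂ :=
  Fintype.linearCombination R fun p =>
    (Pi.single (p.1.succAbove 1, p.2) (ξ (p.1.succAbove 0)) -
        Pi.single (p.1.succAbove 0, p.2) (ξ (p.1.succAbove 1)),
      (-1 : R) ^ (p.1.val + 1) • v p)

/-- The submodule of `(K₁ ⊗ F₃) ⊕ F₂` generated by all `e i ⊗ w l` and by `U ⊆ F₂`. -/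
def starF2 (Λ : Type*) [DecidableEq Λ] {F₂ : Type*} [AddCommGroup F₂] [Module R F₂]
    (U : Set F₂) : Submodule R ((Fin 3 × Λ → R) × F₂) :=
  Submodule.span R
    ((Set.range fun p : Fin 3 × Λ => (Pi.single p (1 : R), (0 : F₂))) ∪
      (fun u : F₂ => ((0 : Fin 3 × Λ → R), u)) '' U)

/-- The degree two part `S₂` of `R[A, B, C]`, with basis the monomials of degree two.
The variables `A, B, C` are `0, 1, 2 : Fin 3`, and the product of two variables `M`, `N` is
`s(M, N) : Sym2 (Fin 3)`. -/
abbrev S2 (R : Type*) := Sym2 (Fin 3) → R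

/-- A monomial of degree two in the first summand of `S₂ ⊕ S₂`. -/
def sq (R : Type*) [CommRing R] (N : Sym2 (Fin 3)) : S2 R × S2 R := (Pi.single N 1, 0)

/-- A monomial of degree two in the second summand of `S₂ ⊕ S₂`. -/
def an (R : Type*) [CommRing R] (N : Sym2 (Fin 3)) : S2 R × S2 R := (0, Pi.single N 1)

/-- For `f = x A + y ^ β B + z ^ γ C` and `g = y ^ β' A + z ^ γ' B + x ^ 2 C`, the map
`S₁ → S₂ ⊕ S₂`, `h ↦ (- g h, f h)`, on the basis `A, B, C` of `S₁`. -/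
def phi13 (x y z : R) (β γ β' γ' : ℕ) (M : Fin 3) : S2 R × S2 R :=
  -(y ^ β' • sq R s(0, M) + z ^ γ' • sq R s(1, M) + x ^ 2 • sq R s(2, M)) +
    (x • an R s(0, M) + y ^ β • an R s(1, M) + z ^ γ • an R s(2, M))

/-- The family `v¹`, for which
`phi13 M = x • v¹ (0, M) + y ^ β • v¹ (1, M) + z ^ γ • v¹ (2, M)`. -/
def v1 (x y z : R) (β γ β' γ' : ℕ) (p : Fin 3 × Fin 3) : S2 R × S2 R :=
  match p.1 with
  | 0 => an R s(0, p.2) - x • sq R s(2, p.2)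
  | 1 => an R s(1, p.2) - y ^ (β' - β) • sq R s(0, p.2)
  | 2 => an R s(2, p.2) - z ^ (γ' - γ) • sq R s(1, p.2)

/-- The module `F²₂`, generated in `(K₁ ⊗ S₁) ⊕ (S₂ ⊕ S₂)` by `K₁ ⊗ S₁` and by the monomials
of the first summand `S₂`. -/
abbrev F22 (R : Type*) [CommRing R] :
    Submodule R ((Fin 3 × Fin 3 → R) × (S2 R × S2 R)) :=
  starF2 (Fin 3) (Set.range (sq R))

/-- The element `[i, M]` of `F²₂`. -/
def br (R : Type*) [CommRing R] (i M : Fin 3) : F22 R :=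
  ⟨(Pi.single (i, M) 1, 0), Submodule.subset_span (Or.inl ⟨(i, M), rfl⟩)⟩

/-- The element `⟨[N]⟩` of `F²₂`. -/
def abr (R : Type*) [CommRing R] (N : Sym2 (Fin 3)) : F22 R :=
  ⟨(0, sq R N), Submodule.subset_span (Or.inr ⟨sq R N, ⟨N, rfl⟩, rfl⟩)⟩

/-- The basis `w²` of `F²₃`, in the order `(1, B)`, `(1, C)`, `(2, C)`:
`-ě₁ ⊗ B - ě₂ ⊗ A`, `-ě₁ ⊗ C + ě₃ ⊗ A`, `ě₂ ⊗ C + ě₃ ⊗ B`. -/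
def w2 (R : Type*) [CommRing R] (l : Fin 3) : Fin 3 × Fin 3 → R :=
  match l with
  | 0 => -Pi.single (0, 1) 1 - Pi.single (1, 0) 1
  | 1 => -Pi.single (0, 2) 1 + Pi.single (2, 0) 1
  | 2 => Pi.single (1, 2) 1 + Pi.single (2, 1) 1

/-- The family `v²` in `F²₂`. The second index `0, 1, 2` stands for
`(1, B)`, `(1, C)`, `(2, C)`. -/
def v2 (y z : R) (β γ β' γ' : ℕ) (p : Fin 3 × Fin 3) : F22 R :=
  match p with
  | (0, 0) => -br R 2 0 - abr R s(1, 2)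
  | (1, 0) => -br R 2 1 + y ^ (β' - 2 * β) • abr R s(0, 0)
  | (2, 0) => br R 1 1 + br R 0 0
  | (0, 1) => br R 1 0 - abr R s(2, 2)
  | (1, 1) => -br R 2 2 - br R 0 0
  | (2, 1) => br R 1 2 + z ^ (γ' - 2 * γ) • abr R s(0, 1)
  | (0, 2) => br R 2 2 + br R 1 1
  | (1, 2) => -br R 0 1 - y ^ (β' - 2 * β) • abr R s(0, 2)
  | (2, 2) => -br R 0 2 + z ^ (γ' - 2 * γ) • abr R s(1, 1)

end StarTransform

end

/-! Abbreviate the first row of the matrix to `x, y, z` (so `y`, `z` now stand for the powers with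
exponents `β`, `γ`), the second row to `p, q, w`, and put `f = x A + y B + z C`, `g = p A + q B + w
C` in `S = R[A, B, C]`.

Resolution. The Rees algebra of `I` is `S/(f, g)`, and `f, g` have only the Koszul relation
(`RegularMatrix.exists_of_eval₂_eq_zero`, `RegularMatrix.exists_of_mul_add_mul_eq_zero`). Both facts
follow by eliminating `A`. In degree three this gives a free resolution `0 → S₁ → S₂ ⊕ S₂ → S₃ → R`
of `R/I³`, with last differential `h ↦ (g h, -f h)`.

Residues. For a regular sequence `u, v, t` with `J = (u, v, t)`, the double complex of this
resolution and the Koszul complex identifies `(I³ : J)/I³` with `{h ∈ S₁/J S₁ : f h = g h = 0 in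
S₂/J S₂}`. `residueRelation` records this as a linear relation rather than a map, which avoids
choices.

Symbolic power. `R/I` has dimension one and `x` is regular on it, so an element `r` of the symbolic
power is multiplied into `I³` by `J = (x^a, y^b, z^c)` for large exponents. Its residue `h`
satisfies `f h ≡ 0` modulo `J`; since `2` is a unit, this forces `Q² h ⊆ J S₁`
(`ProductMem.mul_mem`), that is, `Q² r ⊆ I³`. Conversely `x² r ∈ I³` puts `r` in the symbolic power.
Positive depth follows, as `x` is regular modulo a symbolic power.

Length. Now take `J = (x², y², z²)`. The coefficients of `g` lie in `J`, so only `f h ≡ 0` remains.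
The solutions modulo `J` have a filtration with two layers, each isomorphic to `(R/Q)³`
(`PowerRegular.length_productKernel`): the multiples of `xyz`, and the family `kernelParam`.

The statements about `v²` are direct computations. For the basis, `[1,A]`, `[2,B]`, `[3,C]` are
recovered from their pairwise sums by halving. -/

/-- Elements `u, v, w` form an `M`-regular sequence in the weak sense (`M ⧸ (u, v, w) M` may
vanish), expressed elementwise. -/
structure RegTriple {R : Type*} [CommRing R] (u v w : R) (M : Type*) [AddCommGroup M]
    [Module R M] : Prop where
  fst : ∀ m : M, u • m = 0 → m = 0
  snd : ∀ m m' : M, v • m = u • m' → ∃ n, m = u • n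
  thd : ∀ m m₁ m₂ : M, w • m = u • m₁ + v • m₂ → ∃ n₁ n₂, m = u • n₁ + v • n₂

/-! ### Exactness of the Koszul complex of a regular triple. -/

namespace RegTriple

variable {R : Type*} [CommRing R] {u v w : R} {M : Type*} [AddCommGroup M] [Module R M]

lemma cancel (h : RegTriple u v w M) {m n : M} (e : u • m = u • n) : m = n := by
  rw [← sub_eq_zero]; apply h.fst; rw [smul_sub, e, sub_self]

/-- Exactness of the Koszul complex in degree one. -/
lemma koszul_one (h : RegTriple u v w M) {m₁ m₂ m₃ : M}
    (e : u • m₁ + v • m₂ + w • m₃ = 0) :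
    ∃ b₁ b₂ b₃ : M, m₁ = w • b₂ - v • b₃ ∧ m₂ = u • b₃ - w • b₁ ∧ m₃ = v • b₁ - u • b₂ := by
  obtain ⟨n₁, n₂, rfl⟩ := h.thd m₃ (-m₁) (-m₂) (by linear_combination (norm := module) e)
  obtain ⟨n₃, h₃⟩ := h.snd (m₂ + w • n₂) (-m₁ - w • n₁) (by linear_combination (norm := module) e)
  refine ⟨n₂, -n₁, n₃, ?_, ?_, ?_⟩
  · apply h.cancel
    linear_combination (norm := module) e - v • h₃
  · linear_combination (norm := module) h₃
  · module

/-- Exactness of the Koszul complex in degree two. -/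
lemma koszul_two (h : RegTriple u v w M) {m₁ m₂ m₃ : M}
    (e : v • m₁ = u • m₂) (e' : w • m₁ = u • m₃) :
    ∃ n : M, m₁ = u • n ∧ m₂ = v • n ∧ m₃ = w • n := by
  obtain ⟨n, rfl⟩ := h.snd _ _ e
  refine ⟨n, rfl, h.cancel ?_, h.cancel ?_⟩
  · rw [← e, smul_comm]
  · rw [← e', smul_comm]

end RegTriple

/-! ### Systems of parameters as regular sequences. -/

section Regularity

variable {R : Type*} [CommRing R]

lemma regTriple_of_isWeaklyRegular {r₁ r₂ r₃ : R}
    (h : RingTheory.Sequence.IsWeaklyRegular R [r₁, r₂, r₃]) : RegTriple r₁ r₂ r₃ R := by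
  have h0 := h.regular_mod_prev 0 (by simp)
  have h1 := h.regular_mod_prev 1 (by simp)
  have h2 := h.regular_mod_prev 2 (by simp)
  have key : ∀ (J : Ideal R) (r : R), IsSMulRegular (R ⧸ J) r → ∀ a, r * a ∈ J → a ∈ J := by
    intro J r hr a ha
    rw [← Ideal.Quotient.eq_zero_iff_mem]
    apply hr.right_eq_zero_of_smul
    rw [← Ideal.Quotient.mk_eq_mk, ← Submodule.Quotient.mk_smul, Submodule.Quotient.mk_eq_zero]
    exact ha
  refine ⟨fun m hm => ?_, fun m m' hm => ?_, fun m m₁ m₂ hm => ?_⟩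
  · simpa [Ideal.ofList_nil] using key _ _ h0 m (by simpa [Ideal.ofList_nil] using hm)
  · have := key _ _ h1 m (by
      simpa [Ideal.ofList_cons, Ideal.mem_span_singleton] using ⟨m', hm⟩)
    have : r₁ ∣ m := by simpa [Ideal.ofList_cons, Ideal.mem_span_singleton] using this
    exact this
  · have := key _ _ h2 m (by
      simpa [Ideal.ofList_cons, ← Ideal.span_insert, Ideal.mem_span_pair] using
        ⟨m₁, m₂, by simp only [smul_eq_mul] at hm; linear_combination -hm⟩)
    simp only [List.take, Ideal.ofList_cons, Ideal.ofList_nil, sup_bot_eq, smul_eq_mul,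
      Ideal.mul_top, ← Ideal.span_insert, Ideal.mem_span_pair] at this
    obtain ⟨a, b, rfl⟩ := this
    exact ⟨a, b, by simp only [smul_eq_mul]; ring⟩

/-- If the ideal `(u, v, w)` contains a regular sequence of length three, then the relations
of `u, v, w` are the Koszul relations. -/
lemma koszul_one_of_regTriple_mem {u v w r₁ r₂ r₃ : R} (hr : RegTriple r₁ r₂ r₃ R)
    (h₁ : r₁ ∈ Ideal.span {u, v, w}) (h₂ : r₂ ∈ Ideal.span {u, v, w})
    (h₃ : r₃ ∈ Ideal.span {u, v, w}) {m₁ m₂ m₃ : R} (e : u * m₁ + v * m₂ + w * m₃ = 0) :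
    ∃ k₁ k₂ k₃ : R, m₁ = v * k₃ - w * k₂ ∧ m₂ = w * k₁ - u * k₃ ∧ m₃ = u * k₂ - v * k₁ := by
  obtain ⟨α₁, β₁, γ₁, h₁⟩ := Submodule.mem_span_triple.mp h₁
  obtain ⟨α₂, β₂, γ₂, h₂⟩ := Submodule.mem_span_triple.mp h₂
  obtain ⟨α₃, β₃, γ₃, h₃⟩ := Submodule.mem_span_triple.mp h₃
  obtain ⟨f, s, t⟩ := hr
  simp only [smul_eq_mul] at *
  have cancel : ∀ a b, r₁ * a = r₁ * b → a = b := fun a b h =>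
    sub_eq_zero.mp (f _ (by linear_combination h))
  -- the Koszul complex of `R ⧸ (r₁)` is exact in degree two
  have H : ∀ n₁ n₂ n₃ a b c : R, v * n₁ - u * n₂ = r₁ * a → w * n₁ - u * n₃ = r₁ * b →
      w * n₂ - v * n₃ = r₁ * c → ∃ t k₁ k₂ k₃, n₁ = u * t + r₁ * k₁ ∧ n₂ = v * t + r₁ * k₂ ∧
        n₃ = w * t + r₁ * k₃ := by
    intro n₁ n₂ n₃ a b c ha hb hc
    -- Contraction with the coefficients of `r₂` is a homotopy for multiplication by `r₂`.
    -- Contraction with those of `r₃` then shows that the resulting element of degree three lies in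
    -- `(r₁, r₂)`; its `r₂`-part `l` is the preimage sought.
    obtain ⟨k, l, hkl⟩ := t (α₂ * n₁ + β₂ * n₂ + γ₂ * n₃)
      (α₃ * (-β₂ * a - γ₂ * b) + β₃ * (α₂ * a - γ₂ * c) + γ₃ * (α₂ * b + β₂ * c))
      (α₃ * n₁ + β₃ * n₂ + γ₃ * n₃) (by
        rw [← h₃, ← h₂]
        linear_combination (-α₃ * β₂ + β₃ * α₂) * ha + (-α₃ * γ₂ + γ₃ * α₂) * hb +
          (-β₃ * γ₂ + γ₃ * β₂) * hc)
    obtain ⟨k₁, e₁⟩ := s (n₁ - u * l) (u * k + β₂ * a + γ₂ * b) (by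
      linear_combination u * hkl - n₁ * h₂ + β₂ * ha + γ₂ * hb)
    obtain ⟨k₂, e₂⟩ := s (n₂ - v * l) (v * k - α₂ * a + γ₂ * c) (by
      linear_combination v * hkl - n₂ * h₂ - α₂ * ha + γ₂ * hc)
    obtain ⟨k₃, e₃⟩ := s (n₃ - w * l) (w * k - α₂ * b - β₂ * c) (by
      linear_combination w * hkl - n₃ * h₂ - α₂ * hb - β₂ * hc)
    exact ⟨l, k₁, k₂, k₃, by linear_combination e₁, by linear_combination e₂,
      by linear_combination e₃⟩
  -- Contracting the cycle with the coefficients of `r₁` gives a chain whose boundary is `r₁` times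
  -- the cycle up to sign, hence a cycle modulo `r₁`.
  obtain ⟨l, k₁, k₂, k₃, e₁, e₂, e₃⟩ := H (γ₁ * m₂ - β₁ * m₃) (α₁ * m₃ - γ₁ * m₁)
    (β₁ * m₁ - α₁ * m₂) (-m₃) m₂ (-m₁)
    (by rw [← h₁]; linear_combination γ₁ * e)
    (by rw [← h₁]; linear_combination -β₁ * e)
    (by rw [← h₁]; linear_combination α₁ * e)
  refine ⟨k₁, k₂, k₃, ?_, ?_, ?_⟩
  · apply cancel
    linear_combination v * e₃ - w * e₂ - m₁ * h₁ + α₁ * e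
  · apply cancel
    linear_combination w * e₁ - u * e₃ - m₂ * h₁ + β₁ * e
  · apply cancel
    linear_combination u * e₂ - v * e₁ - m₃ * h₁ + γ₁ * e

/-- In a Noetherian local ring, elements of the maximal ideal generating an ideal that contains
a regular sequence of length three form a regular sequence. -/
lemma regTriple_of_regTriple_mem [IsLocalRing R] [IsNoetherianRing R] {u v w r₁ r₂ r₃ : R}
    (hv : v ∈ maximalIdeal R) (hw : w ∈ maximalIdeal R)
    (hr : RegTriple r₁ r₂ r₃ R)
    (h₁ : r₁ ∈ Ideal.span {u, v, w}) (h₂ : r₂ ∈ Ideal.span {u, v, w})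
    (h₃ : r₃ ∈ Ideal.span {u, v, w}) : RegTriple u v w R := by
  have K {m₁ m₂ m₃ : R} := koszul_one_of_regTriple_mem (m₁ := m₁) (m₂ := m₂) (m₃ := m₃) hr h₁ h₂ h₃
  have S : ∀ m m' : R, v * m = u * m' → ∃ n, m = u * n := by
    -- Nakayama: the Koszul relations give `(u) : v ⊆ (u) + w ((u) : v)`.
    have : (Ideal.span {u}).colon ({v} : Set R) ≤ Ideal.span {u} := by
      apply Submodule.le_of_le_smul_of_le_jacobson_bot (I := maximalIdeal R)
        (IsNoetherian.noetherian _)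
      · rw [IsLocalRing.jacobson_eq_maximalIdeal _ bot_ne_top]
      · intro m hm
        rw [Submodule.mem_colon_singleton, smul_eq_mul, Ideal.mem_span_singleton] at hm
        obtain ⟨m', hm⟩ := hm
        obtain ⟨k₁, k₂, k₃, e₁, e₂, e₃⟩ := K (m₁ := -m') (m₂ := m) (m₃ := 0)
          (by linear_combination hm)
        rw [e₂, sub_eq_add_neg, add_comm]
        refine Submodule.add_mem_sup ?_ ?_
        · rw [Ideal.mem_span_singleton]; exact ⟨-k₃, by ring⟩
        · refine Submodule.smul_mem_smul hw ?_
          rw [Submodule.mem_colon_singleton, smul_eq_mul, Ideal.mem_span_singleton]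
          exact ⟨k₂, by linear_combination e₃⟩
    intro m m' e
    have := @this m (by
      rw [Submodule.mem_colon_singleton, smul_eq_mul, Ideal.mem_span_singleton]
      exact ⟨m', by linear_combination e⟩)
    rwa [Ideal.mem_span_singleton] at this
  refine ⟨?_, S, ?_⟩
  -- Nakayama again: the annihilator of `u` is contained in `(v, w)` times itself.
  · have : (⊥ : Ideal R).colon ({u} : Set R) ≤ ⊥ := by
      apply Submodule.le_of_le_smul_of_le_jacobson_bot (I := maximalIdeal R)
        (IsNoetherian.noetherian _)
      · rw [IsLocalRing.jacobson_eq_maximalIdeal _ bot_ne_top]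
      · intro m hm
        rw [Submodule.mem_colon_singleton, smul_eq_mul, Ideal.mem_bot] at hm
        obtain ⟨k₁, k₂, k₃, e₁, e₂, e₃⟩ := K (m₁ := m) (m₂ := 0) (m₃ := 0)
          (by linear_combination hm)
        obtain ⟨n, rfl⟩ := S k₁ k₂ (by linear_combination e₃)
        rw [bot_sup_eq, show m = v * (k₃ - w * n) - w * (k₂ - v * n) by
          linear_combination e₁]
        refine Submodule.sub_mem _ (Submodule.smul_mem_smul hv ?_) (Submodule.smul_mem_smul hw ?_)
        · rw [Submodule.mem_colon_singleton, smul_eq_mul, Ideal.mem_bot]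
          linear_combination e₂
        · rw [Submodule.mem_colon_singleton, smul_eq_mul, Ideal.mem_bot]
          linear_combination -e₃
    intro m e
    exact @this m (by rwa [Submodule.mem_colon_singleton, smul_eq_mul, Ideal.mem_bot, mul_comm])
  · intro m m₁ m₂ e
    simp only [smul_eq_mul] at e ⊢
    obtain ⟨k₁, k₂, k₃, e₁, e₂, e₃⟩ := K (m₁ := m₁) (m₂ := m₂) (m₃ := -m)
      (by linear_combination -e)
    exact ⟨-k₂, k₁, by linear_combination -e₃⟩

open CategoryTheory CategoryTheory.Abelian in
/-- In a Cohen-Macaulay local ring of dimension three, systems of parameters are regular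
sequences. -/
lemma regTriple_of_maximalIdeal_le_radical [IsLocalRing R] (hCM : IsCohenMacaulayLocal R)
    (hdim : ringKrullDim R = 3) {u v w : R} (hu : u ∈ maximalIdeal R) (hv : v ∈ maximalIdeal R)
    (hw : w ∈ maximalIdeal R) (h : maximalIdeal R ≤ (Ideal.span {u, v, w}).radical) :
    RegTriple u v w R := by
  obtain ⟨hN, hd⟩ := hCM
  have hq : Ideal.span {u, v, w} ≤ maximalIdeal R := by
    rw [Ideal.span_le]; rintro _ (rfl | rfl | rfl) <;> assumption
  have hd : localDepth R R = 3 := by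
    rw [hdim] at hd; exact WithBot.coe_injective hd
  obtain ⟨rs, hrs, hm, hl⟩ : ∃ rs : List R, RingTheory.Sequence.IsRegular R rs ∧
      (∀ r ∈ rs, r ∈ maximalIdeal R) ∧ 3 ≤ rs.length := by
    by_contra! hc
    have : localDepth R R ≤ 2 := iSup_le fun ⟨rs, hrs, hm⟩ => by
      have := hc rs hrs hm
      exact_mod_cast Nat.lt_succ_iff.mp this
    rw [hd] at this
    exact absurd this (by decide)
  have lt_top : ∀ J : Ideal R, J ≤ maximalIdeal R → J • (⊤ : Submodule R R) < ⊤ := by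
    intro J hJ
    rw [smul_eq_mul, Ideal.mul_top]
    exact lt_of_le_of_lt hJ (lt_top_iff_ne_top.mpr (Ideal.IsPrime.ne_top'))
  have supp : Module.support R (R ⧸ maximalIdeal R) = PrimeSpectrum.zeroLocus (maximalIdeal R) := by
    rw [Module.support_eq_zeroLocus, Ideal.annihilator_quotient]
  -- Rees' criterion, used in both directions: a regular sequence of length at least three in the
  -- maximal ideal makes the Ext groups of the residue field in degrees below three vanish. The
  -- residue field has support `V(u, v, w)`, so `(u, v, w)` also contains a regular sequence of
  -- length three.
  have ext := ModuleCat.subsingleton_ext_of_exists_isRegular (maximalIdeal R)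
    (ModuleCat.of R (R ⧸ maximalIdeal R)) supp.subset (ModuleCat.of R R) (lt_top _ le_rfl) rs hm hrs
  obtain ⟨rs, hl, hm, hrs⟩ := ModuleCat.exists_isRegular_of_exists_subsingleton_ext
    (Ideal.span {u, v, w}) 3 (ModuleCat.of R R) (lt_top _ hq)
    (ModuleCat.of R (R ⧸ maximalIdeal R)) (by
      refine supp.trans ?_
      rw [PrimeSpectrum.zeroLocus_eq_iff]
      refine le_antisymm ?_ (Ideal.radical_mono hq)
      exact Ideal.radical_le_radical_iff.mpr h)
    fun i hi => ext i (hi.trans_le hl)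
  match rs, hl, hm, hrs with
  | [r₁, r₂, r₃], _, hm, hrs =>
    exact regTriple_of_regTriple_mem hv hw (regTriple_of_isWeaklyRegular hrs.1)
      (hm r₁ (by simp)) (hm r₂ (by simp)) (hm r₃ (by simp))

end Regularity

/-! ### Ideals generated by one or two linear polynomials in one variable. -/

section LinearPolynomials

open Polynomial

variable {P : Type*} [CommRing P]

/-- Descending induction on coefficients: once the coefficient of `t` in degree `n + 1` is in `J`,
the coefficient of the product in degree `n + 1` reduces to `p` times that of `t` in degree `n`. -/
lemma Polynomial.mem_map_C_of_linear_mul_mem {J : Ideal P} {p e : P}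
    (hp : ∀ d, p * d ∈ J → d ∈ J) {t : P[X]} (h : (C p * X + C e) * t ∈ J.map C) :
    t ∈ J.map C := by
  rw [Ideal.mem_map_C_iff] at h ⊢
  have key : ∀ k n, t.natDegree < n + k → t.coeff n ∈ J := by
    intro k
    induction k with
    | zero => intro n hn; rw [coeff_eq_zero_of_natDegree_lt (by simpa using hn)]; exact J.zero_mem
    | succ k ih =>
      intro n hn
      have h1 := ih (n + 1) (by omega)
      have h2 := h (n + 1)
      rw [add_mul, mul_assoc, coeff_add, coeff_C_mul, coeff_C_mul, coeff_X_mul] at h2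
      exact hp _ ((Ideal.add_mem_iff_left _ (J.mul_mem_left _ h1)).mp h2)
  exact fun n => key (t.natDegree + 1) n (by omega)

variable {x e : P}

lemma Polynomial.linear_mul_eq_zero (hx : ∀ d, x * d = 0 → d = 0) {s : P[X]}
    (h : (C x * X + C e) * s = 0) : s = 0 := by
  have := Polynomial.mem_map_C_of_linear_mul_mem (J := ⊥) (p := x) (e := e) (t := s)
    (by simpa using hx) (by rw [h]; exact Ideal.zero_mem _)
  simpa using this

lemma Polynomial.C_mul_eq_zero (hx : ∀ d, x * d = 0 → d = 0) {s : P[X]}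
    (h : C x * s = 0) : s = 0 := by
  ext n
  apply hx
  rw [← coeff_C_mul, h, coeff_zero]

lemma Polynomial.C_mul_cancel (hx : ∀ d, x * d = 0 → d = 0) {s t : P[X]}
    (h : C x * s = C x * t) : s = t :=
  sub_eq_zero.mp (C_mul_eq_zero hx (by rw [mul_sub, h, sub_self]))

lemma Polynomial.C_dvd_of_C_dvd_mul (he : ∀ d, x ∣ e * d → x ∣ d) {s : P[X]}
    (h : C x ∣ C e * s) : C x ∣ s := by
  rw [C_dvd_iff_dvd_coeff] at h ⊢
  exact fun i => he _ (by simpa using h i)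

/-- The constant `x` is regular modulo the linear polynomial `x X + e`. -/
lemma Polynomial.linear_dvd_of_dvd_C_mul (hx : ∀ d, x * d = 0 → d = 0)
    (he : ∀ d, x ∣ e * d → x ∣ d) {s : P[X]} (h : (C x * X + C e) ∣ C x * s) :
    (C x * X + C e) ∣ s := by
  obtain ⟨α, h⟩ := h
  obtain ⟨α', rfl⟩ := C_dvd_of_C_dvd_mul (s := α) he ⟨s - X * α, by linear_combination -h⟩
  exact ⟨α', C_mul_cancel hx (by linear_combination h)⟩

lemma Polynomial.linear_dvd_of_dvd_C_pow_mul (hx : ∀ d, x * d = 0 → d = 0)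
    (he : ∀ d, x ∣ e * d → x ∣ d) (n : ℕ) {s : P[X]} (h : (C x * X + C e) ∣ C x ^ n * s) :
    (C x * X + C e) ∣ s := by
  induction n with
  | zero => simpa using h
  | succ n ih => exact ih (linear_dvd_of_dvd_C_mul hx he (by rwa [← mul_assoc, ← pow_succ']))

/-- Pseudo-division by a linear polynomial. -/
lemma Polynomial.exists_C_pow_mul_eq (x e : P) (F : P[X]) :
    ∃ (n : ℕ) (H : P[X]) (G : P), C x ^ n * F = (C x * X + C e) * H + C G := by
  induction F using Polynomial.induction_on with
  | C a => exact ⟨0, 0, a, by simp⟩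
  | add p q hp hq =>
    obtain ⟨n, H, G, h⟩ := hp
    obtain ⟨m, H', G', h'⟩ := hq
    refine ⟨n + m, C x ^ m * H + C x ^ n * H', x ^ m * G + x ^ n * G', ?_⟩
    simp only [C_add, C_mul, C_pow]
    linear_combination C x ^ m * h + C x ^ n * h'
  | monomial k a h =>
    obtain ⟨n, H, G, h⟩ := h
    refine ⟨n + 1, C x * X * H + C G, -e * G, ?_⟩
    simp only [C_mul, C_neg]
    linear_combination C x * X * h

/-- If `x, e` is regular, then `x X + e` generates the kernel of every evaluation map that
vanishes on it and is injective on constants. -/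
lemma Polynomial.linear_dvd_of_map_eq_zero {T : Type*} [CommRing T] (hx : ∀ d, x * d = 0 → d = 0)
    (he : ∀ d, x ∣ e * d → x ∣ d) (ev : P[X] →+* T) (hf : ev (C x * X + C e) = 0)
    (hker : ∀ G : P, ev (C G) = 0 → G = 0) {F : P[X]} (hF : ev F = 0) :
    (C x * X + C e) ∣ F := by
  obtain ⟨n, H, G, h⟩ := exists_C_pow_mul_eq x e F
  have : ev (C G) = 0 := by
    have := congrArg ev h
    rw [map_mul, map_add, map_mul, hF, hf] at this
    simpa using this.symm
  rw [hker G this, C_0, add_zero] at h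
  exact linear_dvd_of_dvd_C_pow_mul hx he n ⟨H, h⟩

variable {p e' : P}

/-- The constant `x` is regular modulo the linear polynomials `x X + e` and `p X + e'`. -/
lemma Polynomial.exists_of_C_mul_eq (hx : ∀ d, x * d = 0 → d = 0)
    (he : ∀ d, x ∣ e * d → x ∣ d) (hp : ∀ d, p * d ∈ Ideal.span {x, e} → d ∈ Ideal.span {x, e})
    {s α β : P[X]} (h : C x * s = (C x * X + C e) * α + (C p * X + C e') * β) :
    ∃ α' β', s = (C x * X + C e) * α' + (C p * X + C e') * β' := by
  have hmap : (Ideal.span {x, e}).map C = Ideal.span {(C x : P[X]), C e} := by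
    rw [Ideal.map_span, Set.image_pair]
  -- Modulo `x` and `e` the relation reads `(p X + e') β = 0`, and `p` is regular there.
  have h1 : β ∈ (Ideal.span {x, e}).map C := by
    refine mem_map_C_of_linear_mul_mem (p := p) (e := e') hp ?_
    rw [hmap, Ideal.mem_span_pair]
    exact ⟨s - X * α, -α, by linear_combination h⟩
  rw [hmap, Ideal.mem_span_pair] at h1
  obtain ⟨β₁, β₂, rfl⟩ := h1
  obtain ⟨α₁, h2⟩ := C_dvd_of_C_dvd_mul (s := α + (C p * X + C e') * β₂) he
    ⟨s - X * α - (C p * X + C e') * β₁, by linear_combination -h⟩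
  refine ⟨α₁, β₁ - X * β₂, C_mul_cancel hx ?_⟩
  linear_combination h + (C x * X + C e) * h2

lemma Polynomial.exists_of_C_pow_mul_eq (hx : ∀ d, x * d = 0 → d = 0)
    (he : ∀ d, x ∣ e * d → x ∣ d) (hp : ∀ d, p * d ∈ Ideal.span {x, e} → d ∈ Ideal.span {x, e})
    (n : ℕ) {s α β : P[X]} (h : C x ^ n * s = (C x * X + C e) * α + (C p * X + C e') * β) :
    ∃ α' β', s = (C x * X + C e) * α' + (C p * X + C e') * β' := by
  induction n generalizing α β with
  | zero => exact ⟨α, β, by simpa using h⟩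
  | succ n ih =>
    obtain ⟨α', β', h'⟩ := exists_of_C_mul_eq hx he hp (s := C x ^ n * s) (α := α) (β := β)
      (by rw [← mul_assoc, ← pow_succ', h])
    exact ih h'

/-- The linear polynomials `x X + e` and `p X + e'` only have the Koszul relation. -/
lemma Polynomial.exists_of_linear_mul_add_eq_zero (hx : ∀ d, x * d = 0 → d = 0)
    (he : ∀ d, x ∣ e * d → x ∣ d) (hδ : ∀ d, (x * e' - p * e) * d = 0 → d = 0)
    {s t : P[X]} (h : (C x * X + C e) * s + (C p * X + C e') * t = 0) :
    ∃ r, s = (C p * X + C e') * r ∧ t = -((C x * X + C e) * r) := by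
  obtain ⟨n, H, G, hn⟩ := exists_C_pow_mul_eq x e t
  have h1 : (C x * X + C e) * (C p * C G + (C x * (C x ^ n * s) + C x * (C p * X + C e') * H)) =
      - C ((x * e' - p * e) * G) := by
    simp only [C_mul, C_sub]
    linear_combination C x ^ (n + 1) * h - C x * (C p * X + C e') * hn
  -- The product of this polynomial with `x X + e` is constant, so `x` kills its leading
  -- coefficient.
  have h2 : C p * C G + (C x * (C x ^ n * s) + C x * (C p * X + C e') * H) = 0 := by
    set k := C p * C G + (C x * (C x ^ n * s) + C x * (C p * X + C e') * H)
    by_contra hk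
    apply hk
    rw [← leadingCoeff_eq_zero]
    apply hx
    have := congrArg (fun q => q.coeff (k.natDegree + 1)) h1
    simp only [add_mul, mul_assoc, coeff_add, coeff_C_mul, coeff_X_mul, coeff_neg, coeff_C_succ,
      coeff_eq_zero_of_natDegree_lt (Nat.lt_succ_self k.natDegree)] at this
    simpa using this
  rw [h2, mul_zero, eq_comm, neg_eq_zero, C_eq_zero] at h1
  rw [hδ G h1, C_0, add_zero] at hn
  obtain ⟨r, hr⟩ := linear_dvd_of_dvd_C_pow_mul hx he n ⟨H, hn⟩
  refine ⟨-r, ?_, by rw [hr]; ring⟩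
  rw [← sub_eq_zero]
  apply linear_mul_eq_zero (e := e) hx
  linear_combination h - (C p * X + C e') * hr

/-- The kernel of an evaluation map vanishing on the linear polynomials `x X + e` and `p X + e'`
is generated by them, provided that its restriction to constants has the right kernel. -/
lemma Polynomial.exists_of_map_eq_zero {T : Type*} [CommRing T] (hx : ∀ d, x * d = 0 → d = 0)
    (he : ∀ d, x ∣ e * d → x ∣ d) (hp : ∀ d, p * d ∈ Ideal.span {x, e} → d ∈ Ideal.span {x, e})
    (ev : P[X] →+* T) (hf : ev (C x * X + C e) = 0)
    (hker : ∀ G : P, ev (C G) = 0 → (x * e' - p * e) ∣ G) {F : P[X]} (hF : ev F = 0) :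
    ∃ α β, F = (C x * X + C e) * α + (C p * X + C e') * β := by
  obtain ⟨n, H, G, h⟩ := exists_C_pow_mul_eq x e F
  have : ev (C G) = 0 := by
    have := congrArg ev h
    rw [map_mul, map_add, map_mul, hF, hf] at this
    simpa using this.symm
  -- The remainder is a multiple of the resultant `x e' - p e = x (p X + e') - p (x X + e)`, hence
  -- in the ideal of the two linear polynomials.
  obtain ⟨G', rfl⟩ := hker G this
  simp only [C_mul, C_sub] at h
  refine exists_of_C_pow_mul_eq hx he hp n (α := H - C p * C G') (β := C x * C G') ?_
  linear_combination h

end LinearPolynomials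

/-! ### Equations of the Rees algebra of the ideal of minors. -/

namespace TernaryForms

open MvPolynomial

variable {R : Type*} [CommRing R]

/-- The conditions on the entries of a `2 × 3` matrix under which the symmetric algebra of the
ideal of its maximal minors is a complete intersection isomorphic to the Rees algebra. -/
structure RegularMatrix (x y z p q w : R) : Prop where
  reg : RegTriple x y z R
  dvd_pow : ∃ n, p ∣ y ^ n
  minors_reg : RegTriple (x * q - y * p) (z * p - x * w) z R

variable {x y z p q w : R}

lemma C_dvd_of_C_dvd_C_mul {σ : Type*} {a b : R} (h : ∀ d, a ∣ b * d → a ∣ d)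
    {s : MvPolynomial σ R} (hs : C a ∣ C b * s) : C a ∣ s := by
  rw [C_dvd_iff_dvd_coeff] at hs ⊢
  exact fun i => h _ (by simpa using hs i)

lemma eq_zero_of_C_mul {σ : Type*} {a : R} (h : ∀ d, a * d = 0 → d = 0)
    {s : MvPolynomial σ R} (hs : C a * s = 0) : s = 0 := by
  ext i
  apply h
  rw [← coeff_C_mul, hs, coeff_zero]

lemma _root_.RegTriple.dvd {u v w : R} (h : RegTriple u v w R) (d : R) (hd : u ∣ v * d) :
    u ∣ d := by
  obtain ⟨c, hc⟩ := hd
  exact h.snd d c hc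

/-- The linear form `a B + b C` is regular modulo the constant `c` if `a` is. -/
lemma C_dvd_of_dvd_binary_mul {a b c : R} (h : ∀ d, c ∣ a * d → c ∣ d) {s : MvPolynomial (Fin 2) R}
    (hs : C c ∣ (C a * X 0 + C b * X 1) * s) : C c ∣ s := by
  have e1 : finSuccEquiv R 1 (X 1) = Polynomial.C (X 0) := finSuccEquiv_X_succ (j := 0)
  have ec : ∀ r, finSuccEquiv R 1 (C r) = Polynomial.C (C r) := fun r =>
    (finSuccEquiv R 1).commutes r
  rw [← map_dvd_iff (finSuccEquiv R 1)] at hs ⊢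
  simp only [map_mul, map_add, finSuccEquiv_X_zero, e1, ec] at hs ⊢
  rw [← Polynomial.C_mul] at hs
  rw [← Ideal.mem_span_singleton, ← Set.image_singleton, ← Ideal.map_span] at hs ⊢
  refine Polynomial.mem_map_C_of_linear_mul_mem ?_ hs
  intro d hd
  rw [Ideal.mem_span_singleton] at hd ⊢
  exact C_dvd_of_C_dvd_C_mul h hd

lemma eq_zero_of_binary_mul {a b : R} (h : ∀ d, a * d = 0 → d = 0) {s : MvPolynomial (Fin 2) R}
    (hs : (C a * X 0 + C b * X 1) * s = 0) : s = 0 := by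
  have := C_dvd_of_dvd_binary_mul (a := a) (b := b) (c := 0) (s := s)
    (by simpa using h) (by rw [hs]; exact dvd_zero _)
  simpa using this

/-- As `p` divides a power of `y`, it suffices that `y` is regular modulo `(x, y B + z C)`. A
relation `y s = x α + (y B + z C) β` gives `z C β ∈ (x, y)`, hence `β ∈ (x, y)` because `z` is
regular modulo `(x, y)`; the part of `β` divisible by `y` is absorbed into `s`. -/
lemma RegularMatrix.p_regular (h : RegularMatrix x y z p q w) (d : MvPolynomial (Fin 2) R)
    (hd : C p * d ∈ Ideal.span {C x, (C y * X 0 + C z * X 1 : MvPolynomial (Fin 2) R)}) :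
    d ∈ Ideal.span {C x, (C y * X 0 + C z * X 1 : MvPolynomial (Fin 2) R)} := by
  set J := Ideal.span {C x, (C y * X 0 + C z * X 1 : MvPolynomial (Fin 2) R)}
  have hy : ∀ s, C y * s ∈ J → s ∈ J := by
    intro s hs
    obtain ⟨α, β, hs⟩ := Ideal.mem_span_pair.mp hs
    have hmap : (Ideal.span {x, y}).map C = Ideal.span {C x, (C y : MvPolynomial (Fin 2) R)} := by
      rw [Ideal.map_span, Set.image_pair]
    have h1 : C z * X 1 * β ∈ (Ideal.span {x, y}).map C := by
      rw [hmap, Ideal.mem_span_pair]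
      exact ⟨-α, s - X 0 * β, by linear_combination -hs⟩
    have h2 : β ∈ (Ideal.span {x, y}).map C := by
      rw [MvPolynomial.mem_map_C_iff] at h1 ⊢
      intro m
      have := h1 (m + Finsupp.single 1 1)
      rw [mul_assoc, coeff_C_mul, mul_comm (X 1), coeff_mul_X] at this
      obtain ⟨a, b, hab⟩ := Ideal.mem_span_pair.mp this
      obtain ⟨n₁, n₂, hn⟩ := h.reg.thd (coeff m β) a b
        (by simp only [smul_eq_mul]; linear_combination -hab)
      rw [hn]
      exact Ideal.mem_span_pair.mpr ⟨n₁, n₂, by simp only [smul_eq_mul]; ring⟩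
    rw [hmap, Ideal.mem_span_pair] at h2
    obtain ⟨β₁, β₂, rfl⟩ := h2
    obtain ⟨γ, hγ⟩ := C_dvd_of_C_dvd_C_mul h.reg.dvd
      (s := s - (C y * X 0 + C z * X 1) * β₂)
      ⟨α + (C y * X 0 + C z * X 1) * β₁, by linear_combination -hs⟩
    exact Ideal.mem_span_pair.mpr ⟨γ, β₂, by linear_combination -hγ⟩
  obtain ⟨n, r, hr⟩ := h.dvd_pow
  have hn : ∀ n, C y ^ n * d ∈ J → d ∈ J := by
    intro n
    induction n with
    | zero => simp
    | succ n ih => exact fun hd => ih (hy _ (by rwa [← mul_assoc, ← pow_succ']))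
  apply hn n
  rw [← C_pow, hr, C_mul, mul_comm (C p), mul_assoc]
  exact J.mul_mem_left _ hd

/-- The forms in `B, C` vanishing at the point `(b, c)`. -/
lemma binary_dvd_of_eval_eq_zero {b c z : R} (h : RegTriple c b z R) {s : MvPolynomial (Fin 2) R}
    (hs : eval₂Hom Polynomial.C ![Polynomial.C b * Polynomial.X, Polynomial.C c * Polynomial.X] s
      = 0) : (C c * X 0 - C b * X 1) ∣ s := by
  have e1 : finSuccEquiv R 1 (X 1) = Polynomial.C (X 0) := finSuccEquiv_X_succ (j := 0)
  have ec : ∀ r, finSuccEquiv R 1 (C r) = Polynomial.C (C r) := fun r =>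
    (finSuccEquiv R 1).commutes r
  set ev : Polynomial (MvPolynomial (Fin 1) R) →+* Polynomial R :=
    Polynomial.eval₂RingHom (eval₂Hom Polynomial.C fun _ => Polynomial.C c * Polynomial.X)
      (Polynomial.C b * Polynomial.X) with hev
  have comp : eval₂Hom Polynomial.C ![Polynomial.C b * Polynomial.X, Polynomial.C c * Polynomial.X]
      = ev.comp (finSuccEquiv R 1 : MvPolynomial (Fin 2) R →+* _) := by
    apply MvPolynomial.ringHom_ext
    · intro r
      simp [hev, ec]
    · intro i
      fin_cases i
      · simp [hev, finSuccEquiv_X_zero]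
      · simp [hev, e1]
  have hc : ∀ d : MvPolynomial (Fin 1) R, C c * d = 0 → d = 0 := fun d => eq_zero_of_C_mul h.fst
  rw [← map_dvd_iff (finSuccEquiv R 1)]
  simp only [map_mul, map_sub, finSuccEquiv_X_zero, e1, ec]
  rw [show Polynomial.C (C c) * Polynomial.X - Polynomial.C (C b) * Polynomial.C (X 0) =
    Polynomial.C (C c) * Polynomial.X + Polynomial.C (-(C b * X (0 : Fin 1))) by
      rw [Polynomial.C_neg, Polynomial.C_mul, sub_eq_add_neg]]
  refine Polynomial.linear_dvd_of_map_eq_zero hc ?_ ev ?_ ?_ (by rw [comp] at hs; exact hs)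
  · intro d hd
    have : C c ∣ C b * (X 0 * d) := by
      rw [← dvd_neg]; convert hd using 1; ring
    have := C_dvd_of_C_dvd_C_mul h.dvd this
    rw [C_dvd_iff_dvd_coeff] at this ⊢
    intro m
    have := this (m + Finsupp.single 0 1)
    rwa [mul_comm, coeff_mul_X] at this
  · simp [hev]; ring
  · intro G hG
    -- On polynomials in the last variable alone the evaluation is the substitution `X ↦ c X`, which
    -- is injective since `c` is regular.
    rw [← (uniqueAlgEquiv R (Fin 1)).map_eq_zero_iff]
    have comp' : (ev.comp Polynomial.C) =
        (Polynomial.compRingHom (Polynomial.C c * Polynomial.X)).comp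
        (uniqueAlgEquiv R (Fin 1) : MvPolynomial (Fin 1) R →+* _) := by
      apply MvPolynomial.ringHom_ext
      · intro r; simp [hev]
      · intro i; simp [hev]
    have := congrArg (fun f => f G) comp'
    simp only [RingHom.comp_apply, hG] at this
    ext n
    have h2 := congrArg (fun f => Polynomial.coeff f n) this
    simp only [Polynomial.coe_compRingHom, Polynomial.coeff_zero] at h2
    rw [Polynomial.comp_C_mul_X_coeff] at h2
    have hpow : ∀ n d, d * c ^ n = 0 → d = 0 := by
      intro n
      induction n with
      | zero => simp
      | succ n ih => exact fun d hd => ih d (h.fst _ (by rw [smul_eq_mul, ← hd]; ring))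
    exact hpow _ _ h2.symm

/-- The linear form with coefficients `x, y, z`. -/
noncomputable def linearForm (x y z : R) : MvPolynomial (Fin 3) R :=
  C x * X 0 + C y * X 1 + C z * X 2

lemma linearForm_isHomogeneous (x y z : R) : (linearForm x y z).IsHomogeneous 1 :=
  (((isHomogeneous_X R 0).C_mul x).add ((isHomogeneous_X R 1).C_mul y)).add
    ((isHomogeneous_X R 2).C_mul z)

lemma finSuccEquiv_linearForm (x y z : R) : finSuccEquiv R 2 (linearForm x y z) =
    Polynomial.C (C x) * Polynomial.X + Polynomial.C (C y * X 0 + C z * X 1) := by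
  have e1 : finSuccEquiv R 2 (X 1) = Polynomial.C (X 0) := finSuccEquiv_X_succ (j := 0)
  have e2 : finSuccEquiv R 2 (X 2) = Polynomial.C (X 1) := finSuccEquiv_X_succ (j := 1)
  have ec : ∀ r, finSuccEquiv R 2 (C r) = Polynomial.C (C r) := fun r =>
    (finSuccEquiv R 2).commutes r
  simp only [linearForm, map_add, map_mul, finSuccEquiv_X_zero, e1, e2, ec]
  ring

namespace RegularMatrix

lemma linearForm_mul_eq_zero (h : RegularMatrix x y z p q w) {s : MvPolynomial (Fin 3) R}
    (hs : linearForm x y z * s = 0) : s = 0 := by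
  replace hs := congrArg (finSuccEquiv R 2) hs
  rw [map_zero, map_mul, finSuccEquiv_linearForm] at hs
  apply (finSuccEquiv R 2).injective
  rw [map_zero]
  exact Polynomial.linear_mul_eq_zero (fun d => eq_zero_of_C_mul h.reg.fst) hs

/-- The resultant of the two linear forms with respect to the first variable: its coefficients are
two of the minors, so it generates the binary forms vanishing at the corresponding point. -/
lemma delta (x y z p q w : R) : (C x * (C q * X 0 + C w * X 1) - C p * (C y * X 0 + C z * X 1) :
    MvPolynomial (Fin 2) R) = C (x * q - y * p) * X 0 - C (z * p - x * w) * X 1 := by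
  simp only [C_sub, C_mul]; ring

lemma exists_of_mul_add_mul_eq_zero (h : RegularMatrix x y z p q w) {s t : MvPolynomial (Fin 3) R}
    (hs : linearForm x y z * s + linearForm p q w * t = 0) :
    ∃ r, s = linearForm p q w * r ∧ t = -(linearForm x y z * r) := by
  replace hs := congrArg (finSuccEquiv R 2) hs
  rw [map_zero, map_add, map_mul, map_mul, finSuccEquiv_linearForm, finSuccEquiv_linearForm] at hs
  obtain ⟨r, h1, h2⟩ := Polynomial.exists_of_linear_mul_add_eq_zero
    (fun d => eq_zero_of_C_mul h.reg.fst) (fun d => C_dvd_of_dvd_binary_mul h.reg.dvd)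
    (fun d hd => by
      rw [delta, sub_eq_add_neg, ← neg_mul, ← C_neg] at hd
      exact eq_zero_of_binary_mul h.minors_reg.fst hd) hs
  refine ⟨(finSuccEquiv R 2).symm r, ?_, ?_⟩
  · apply (finSuccEquiv R 2).injective
    rw [map_mul, finSuccEquiv_linearForm, AlgEquiv.apply_symm_apply, h1]
  · apply (finSuccEquiv R 2).injective
    rw [map_neg, map_mul, finSuccEquiv_linearForm, AlgEquiv.apply_symm_apply, h2]

/-- The defining equations of the Rees algebra of the ideal of maximal minors. -/
lemma exists_of_eval₂_eq_zero (h : RegularMatrix x y z p q w) {s : MvPolynomial (Fin 3) R}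
    (hs : eval₂Hom Polynomial.C (fun i => Polynomial.C
      (![y * w - z * q, z * p - x * w, x * q - y * p] i) * Polynomial.X) s = 0) :
    ∃ α β, s = linearForm x y z * α + linearForm p q w * β := by
  have e1 : finSuccEquiv R 2 (X 1) = Polynomial.C (X 0) := finSuccEquiv_X_succ (j := 0)
  have e2 : finSuccEquiv R 2 (X 2) = Polynomial.C (X 1) := finSuccEquiv_X_succ (j := 1)
  have ec : ∀ r, finSuccEquiv R 2 (C r) = Polynomial.C (C r) := fun r =>
    (finSuccEquiv R 2).commutes r
  set ev : Polynomial (MvPolynomial (Fin 2) R) →+* Polynomial R :=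
    Polynomial.eval₂RingHom (eval₂Hom Polynomial.C
      ![Polynomial.C (z * p - x * w) * Polynomial.X, Polynomial.C (x * q - y * p) * Polynomial.X])
      (Polynomial.C (y * w - z * q) * Polynomial.X) with hev
  have comp : eval₂Hom Polynomial.C (fun i => Polynomial.C
      (![y * w - z * q, z * p - x * w, x * q - y * p] i) * Polynomial.X)
      = ev.comp (finSuccEquiv R 2 : MvPolynomial (Fin 3) R →+* _) := by
    apply MvPolynomial.ringHom_ext
    · intro r
      simp [hev, ec]
    · intro i
      fin_cases i
      · simp [hev, finSuccEquiv_X_zero]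
      · simp [hev, e1]
      · simp [hev, e2]
  obtain ⟨α, β, hab⟩ := Polynomial.exists_of_map_eq_zero (p := C p) (e' := C q * X 0 + C w * X 1)
    (fun d => eq_zero_of_C_mul h.reg.fst) (fun d => C_dvd_of_dvd_binary_mul h.reg.dvd)
    h.p_regular ev (by simp [hev]; ring)
    (fun G hG => by
      rw [delta]
      refine binary_dvd_of_eval_eq_zero h.minors_reg ?_
      simpa [hev] using hG)
    (F := finSuccEquiv R 2 s) (by rw [comp] at hs; exact hs)
  refine ⟨(finSuccEquiv R 2).symm α, (finSuccEquiv R 2).symm β, (finSuccEquiv R 2).injective ?_⟩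
  rw [map_add, map_mul, map_mul, finSuccEquiv_linearForm, finSuccEquiv_linearForm,
    AlgEquiv.apply_symm_apply, AlgEquiv.apply_symm_apply, hab]

end RegularMatrix

/-! ### Passage to homogeneous components. -/

section Homogeneous

variable {σ : Type*}

lemma homogeneousComponent_mul_of_left {i : ℕ} {a : MvPolynomial σ R} (ha : a.IsHomogeneous i)
    (j : ℕ) (b : MvPolynomial σ R) :
    homogeneousComponent (i + j) (a * b) = a * homogeneousComponent j b :=
  letI := MvPolynomial.gradedAlgebra (σ := σ) (R := R)
  have e : ∀ (φ : MvPolynomial σ R) k, ((DirectSum.decompose (homogeneousSubmodule σ R) φ) k :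
      MvPolynomial σ R) = homogeneousComponent k φ :=
    fun φ k => decomposition.decompose'_apply φ k
  e (a * b) (i + j) ▸ e b j ▸ DirectSum.coe_decompose_mul_add_of_left_mem (homogeneousSubmodule σ R)
    (i := i) (j := j) (a := a) (b := b) ha

/-- Links the Rees algebra, where the variables go to multiples of an indeterminate, to plain
evaluation at the minors. -/
lemma eval₂Hom_C_mul_X_of_isHomogeneous {n : ℕ} {s : MvPolynomial σ R} (hs : s.IsHomogeneous n)
    (a : σ → R) : eval₂Hom Polynomial.C (fun i => Polynomial.C (a i) * Polynomial.X) s =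
      Polynomial.C (eval a s) * Polynomial.X ^ n := by
  rw [coe_eval₂Hom, eval₂_eq, eval_eq, map_sum, Finset.sum_mul]
  refine Finset.sum_congr rfl fun d hd => ?_
  rw [map_mul, mul_assoc, map_prod]
  simp only [mul_pow, Finset.prod_mul_distrib, map_pow]
  rw [Finset.prod_pow_eq_pow_sum]
  have : ∑ i ∈ d.support, d i = n := by
    have := hs (mem_support_iff.mp hd)
    rw [← this, Finsupp.weight_apply, Finsupp.sum]
    simp
  rw [this]

end Homogeneous

lemma exists_isHomogeneous_of_eq {f g s α β : MvPolynomial (Fin 3) R} {n : ℕ}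
    (hf : f.IsHomogeneous 1) (hg : g.IsHomogeneous 1) (hs : s.IsHomogeneous (1 + n))
    (h : s = f * α + g * β) : ∃ α' β', α'.IsHomogeneous n ∧ β'.IsHomogeneous n ∧
      s = f * α' + g * β' := by
  refine ⟨_, _, homogeneousComponent_isHomogeneous n α, homogeneousComponent_isHomogeneous n β, ?_⟩
  rw [← homogeneousComponent_mul_of_left hf, ← homogeneousComponent_mul_of_left hg, ← map_add, ← h,
    homogeneousComponent_eq_self hs]

lemma RegularMatrix.exists_of_eval_eq_zero (h : RegularMatrix x y z p q w) {n : ℕ}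
    {s : MvPolynomial (Fin 3) R} (hs : s.IsHomogeneous (1 + n))
    (h0 : eval ![y * w - z * q, z * p - x * w, x * q - y * p] s = 0) :
    ∃ α β, α.IsHomogeneous n ∧ β.IsHomogeneous n ∧
      s = linearForm x y z * α + linearForm p q w * β := by
  obtain ⟨α, β, hab⟩ := h.exists_of_eval₂_eq_zero (s := s) (by
    rw [eval₂Hom_C_mul_X_of_isHomogeneous hs, h0, map_zero, zero_mul])
  exact exists_isHomogeneous_of_eq (linearForm_isHomogeneous _ _ _)
    (linearForm_isHomogeneous _ _ _) hs hab

lemma RegularMatrix.exists_isHomogeneous_of_mul_add_mul_eq_zero (h : RegularMatrix x y z p q w)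
    {n : ℕ} {s t : MvPolynomial (Fin 3) R} (hs : s.IsHomogeneous (1 + n))
    (ht : t.IsHomogeneous (1 + n)) (h0 : linearForm x y z * s + linearForm p q w * t = 0) :
    ∃ r, r.IsHomogeneous n ∧ s = linearForm p q w * r ∧ t = -(linearForm x y z * r) := by
  obtain ⟨r, h1, h2⟩ := h.exists_of_mul_add_mul_eq_zero h0
  refine ⟨_, homogeneousComponent_isHomogeneous n r, ?_, ?_⟩
  · rw [← homogeneousComponent_mul_of_left (linearForm_isHomogeneous _ _ _), ← h1,
      homogeneousComponent_eq_self hs]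
  · rw [← homogeneousComponent_mul_of_left (linearForm_isHomogeneous _ _ _), ← map_neg, ← h2,
      homogeneousComponent_eq_self ht]

end TernaryForms

/-! ### Regular triples on the terms of the resolution. -/

section RegTripleModules

variable {R : Type*} [CommRing R] {u v w : R}

lemma RegTriple.prod {M N : Type*} [AddCommGroup M] [Module R M] [AddCommGroup N] [Module R N]
    (hM : RegTriple u v w M) (hN : RegTriple u v w N) : RegTriple u v w (M × N) := by
  refine ⟨?_, ?_, ?_⟩
  · rintro ⟨a, b⟩ h
    simp only [Prod.smul_mk, Prod.mk_eq_zero] at h ⊢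
    exact ⟨hM.fst _ h.1, hN.fst _ h.2⟩
  · rintro ⟨a, b⟩ ⟨a', b'⟩ h
    simp only [Prod.smul_mk, Prod.mk.injEq] at h
    obtain ⟨c, hc⟩ := hM.snd _ _ h.1
    obtain ⟨d, hd⟩ := hN.snd _ _ h.2
    exact ⟨(c, d), by rw [hc, hd, Prod.smul_mk]⟩
  · rintro ⟨a, b⟩ ⟨a₁, b₁⟩ ⟨a₂, b₂⟩ h
    simp only [Prod.smul_mk, Prod.mk_add_mk, Prod.mk.injEq] at h
    obtain ⟨c, c', hc⟩ := hM.thd _ _ _ h.1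
    obtain ⟨d, d', hd⟩ := hN.thd _ _ _ h.2
    exact ⟨(c, d), (c', d'), by rw [hc, hd]; simp⟩

open MvPolynomial

lemma RegTriple.mvPolynomial (h : RegTriple u v w R) (σ : Type*) :
    RegTriple u v w (MvPolynomial σ R) := by
  refine ⟨fun m hm => ?_, fun m m' hm => ?_, fun m m₁ m₂ hm => ?_⟩
  · rw [smul_eq_C_mul] at hm
    exact TernaryForms.eq_zero_of_C_mul h.fst hm
  · rw [smul_eq_C_mul, smul_eq_C_mul] at hm
    obtain ⟨n, hn⟩ := TernaryForms.C_dvd_of_C_dvd_C_mul h.dvd ⟨m', hm⟩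
    exact ⟨n, by rw [hn, smul_eq_C_mul]⟩
  · have hmap : (Ideal.span {u, v}).map C = Ideal.span {C u, (C v : MvPolynomial σ R)} := by
      rw [Ideal.map_span, Set.image_pair]
    have : m ∈ (Ideal.span {u, v}).map C := by
      rw [mem_map_C_iff]
      intro k
      obtain ⟨a, b, hab⟩ := h.thd (coeff k m) (coeff k m₁) (coeff k m₂)
        (by simpa using congrArg (coeff k) hm)
      exact Ideal.mem_span_pair.mpr ⟨a, b, by rw [hab]; simp only [smul_eq_mul]; ring⟩
    rw [hmap, Ideal.mem_span_pair] at this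
    obtain ⟨a, b, rfl⟩ := this
    exact ⟨a, b, by simp only [smul_eq_C_mul]; ring⟩

lemma RegTriple.homogeneousSubmodule (h : RegTriple u v w R) (σ : Type*) (n : ℕ) :
    RegTriple u v w (MvPolynomial.homogeneousSubmodule σ R n) := by
  have hS := h.mvPolynomial σ
  have e : ∀ m : MvPolynomial.homogeneousSubmodule σ R n,
      homogeneousComponent n (m : MvPolynomial σ R) = m :=
    fun m => homogeneousComponent_eq_self m.2
  refine ⟨fun m hm => Subtype.ext (hS.fst _ (congrArg Subtype.val hm)), fun m m' hm => ?_,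
    fun m m₁ m₂ hm => ?_⟩
  · obtain ⟨a, ha⟩ := hS.snd _ _ (congrArg Subtype.val hm)
    refine ⟨⟨_, homogeneousComponent_mem n a⟩, Subtype.ext ?_⟩
    rw [← e m, ha, map_smul]; rfl
  · obtain ⟨a, b, hab⟩ := hS.thd _ _ _ (congrArg Subtype.val hm)
    refine ⟨⟨_, homogeneousComponent_mem n a⟩, ⟨_, homogeneousComponent_mem n b⟩, Subtype.ext ?_⟩
    rw [← e m, hab, map_add, map_smul, map_smul]; rfl

end RegTripleModules

/-! ### The residue correspondence for a length-three complex. -/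

section ResidueRelation

variable {R : Type*} [CommRing R] {F₀ F₁ F₂ F₃ : Type*}
  [AddCommGroup F₀] [Module R F₀] [AddCommGroup F₁] [Module R F₁]
  [AddCommGroup F₂] [Module R F₂] [AddCommGroup F₃] [Module R F₃]

/-- For a complex `F₃ → F₂ → F₁ → F₀`, the graph-like relation between `F₀` and `F₃` obtained from
the double complex with the Koszul complex of `u, v, w`. -/
def residueRelation (u v w : R) (d₁ : F₁ →ₗ[R] F₀) (d₂ : F₂ →ₗ[R] F₁) (d₃ : F₃ →ₗ[R] F₂) :
    Submodule R (F₀ × F₃) where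
  carrier := {t | ∃ s₁ s₂ s₃ a₁ a₂ a₃, u • t.1 = d₁ s₁ ∧ v • t.1 = d₁ s₂ ∧ w • t.1 = d₁ s₃ ∧
    w • s₂ - v • s₃ = d₂ a₁ ∧ u • s₃ - w • s₁ = d₂ a₂ ∧ v • s₁ - u • s₂ = d₂ a₃ ∧
    d₃ t.2 = u • a₁ + v • a₂ + w • a₃}
  zero_mem' := ⟨0, 0, 0, 0, 0, 0, by simp⟩
  add_mem' := by
    rintro _ _ ⟨s₁, s₂, s₃, a₁, a₂, a₃, h1, h2, h3, h4, h5, h6, h7⟩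
      ⟨s₁', s₂', s₃', a₁', a₂', a₃', h1', h2', h3', h4', h5', h6', h7'⟩
    refine ⟨s₁ + s₁', s₂ + s₂', s₃ + s₃', a₁ + a₁', a₂ + a₂', a₃ + a₃', ?_, ?_, ?_, ?_, ?_, ?_, ?_⟩
    · rw [Prod.fst_add, smul_add, h1, h1', map_add]
    · rw [Prod.fst_add, smul_add, h2, h2', map_add]
    · rw [Prod.fst_add, smul_add, h3, h3', map_add]
    · rw [map_add, ← h4, ← h4']; module
    · rw [map_add, ← h5, ← h5']; module
    · rw [map_add, ← h6, ← h6']; module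
    · rw [Prod.snd_add, map_add, h7, h7']; module
  smul_mem' := by
    rintro r _ ⟨s₁, s₂, s₃, a₁, a₂, a₃, h1, h2, h3, h4, h5, h6, h7⟩
    refine ⟨r • s₁, r • s₂, r • s₃, r • a₁, r • a₂, r • a₃, ?_, ?_, ?_, ?_, ?_, ?_, ?_⟩
    · rw [Prod.smul_fst, smul_comm, h1, map_smul]
    · rw [Prod.smul_fst, smul_comm, h2, map_smul]
    · rw [Prod.smul_fst, smul_comm, h3, map_smul]
    · rw [map_smul, ← h4]; module
    · rw [map_smul, ← h5]; module
    · rw [map_smul, ← h6]; module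
    · rw [Prod.smul_snd, map_smul, h7]; module

variable {u v w : R} {d₁ : F₁ →ₗ[R] F₀} {d₂ : F₂ →ₗ[R] F₁} {d₃ : F₃ →ₗ[R] F₂}

/-- The chase from `F₀` up to `F₃`: lift the multiples of `τ`, take the Koszul combination, which is
a cycle, and lift again. Only exactness of the complex is needed. -/
lemma exists_mem_residueRelation_of_smul_mem (h₁ : Function.Exact d₂ d₁)
    (h₂ : Function.Exact d₃ d₂) {τ : F₀} (hu : u • τ ∈ LinearMap.range d₁)
    (hv : v • τ ∈ LinearMap.range d₁) (hw : w • τ ∈ LinearMap.range d₁) :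
    ∃ h, (τ, h) ∈ residueRelation u v w d₁ d₂ d₃ := by
  obtain ⟨s₁, hs₁⟩ := hu
  obtain ⟨s₂, hs₂⟩ := hv
  obtain ⟨s₃, hs₃⟩ := hw
  obtain ⟨a₁, ha₁⟩ := (h₁ (w • s₂ - v • s₃)).mp (by
    rw [map_sub, map_smul, map_smul, hs₂, hs₃]; module)
  obtain ⟨a₂, ha₂⟩ := (h₁ (u • s₃ - w • s₁)).mp (by
    rw [map_sub, map_smul, map_smul, hs₁, hs₃]; module)
  obtain ⟨a₃, ha₃⟩ := (h₁ (v • s₁ - u • s₂)).mp (by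
    rw [map_sub, map_smul, map_smul, hs₁, hs₂]; module)
  obtain ⟨h, hh⟩ := (h₂ (u • a₁ + v • a₂ + w • a₃)).mp (by
    rw [map_add, map_add, map_smul, map_smul, map_smul, ha₁, ha₂, ha₃]; module)
  exact ⟨h, s₁, s₂, s₃, a₁, a₂, a₃, hs₁.symm, hs₂.symm, hs₃.symm, ha₁.symm, ha₂.symm, ha₃.symm, hh⟩

/-- The chase in the opposite direction, with Koszul exactness on `F₁` and `F₀` providing the
preimages. -/
lemma exists_mem_residueRelation_of_eq (h₁ : Function.Exact d₂ d₁) (h₂ : Function.Exact d₃ d₂)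
    (hF₀ : RegTriple u v w F₀) (hF₁ : RegTriple u v w F₁) {h : F₃} {a₁ a₂ a₃ : F₂}
    (hh : d₃ h = u • a₁ + v • a₂ + w • a₃) :
    ∃ τ, (τ, h) ∈ residueRelation u v w d₁ d₂ d₃ := by
  obtain ⟨s₁, s₂, s₃, e₁, e₂, e₃⟩ := hF₁.koszul_one (m₁ := d₂ a₁) (m₂ := d₂ a₂) (m₃ := d₂ a₃)
    (by rw [← map_smul, ← map_smul, ← map_smul, ← map_add, ← map_add, ← hh]
        exact h₂.apply_apply_eq_zero h)
  obtain ⟨τ, t₁, t₂, t₃⟩ := hF₀.koszul_two (m₁ := d₁ s₁) (m₂ := d₁ s₂) (m₃ := d₁ s₃)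
    (by rw [← sub_eq_zero, ← map_smul, ← map_smul, ← map_sub, ← e₃]
        exact h₁.apply_apply_eq_zero _)
    (by rw [eq_comm, ← sub_eq_zero, ← map_smul, ← map_smul, ← map_sub, ← e₂]
        exact h₁.apply_apply_eq_zero _)
  exact ⟨τ, s₁, s₂, s₃, a₁, a₂, a₃, t₁.symm, t₂.symm, t₃.symm, e₁.symm, e₂.symm, e₃.symm, hh⟩

/-- This makes the relation a bijection on residue classes: one implication says the class of `h` is
well defined, the other that it determines `τ` modulo the image. The chases start from a vanishing
class at one end and correct all intermediate lifts. -/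
lemma mem_range_iff_of_mem_residueRelation (h₁ : Function.Exact d₂ d₁) (h₂ : Function.Exact d₃ d₂)
    (h₃ : Function.Injective d₃) (hF₀ : RegTriple u v w F₀) (hF₁ : RegTriple u v w F₁)
    (hF₂ : RegTriple u v w F₂) {τ : F₀} {h : F₃}
    (hτ : (τ, h) ∈ residueRelation u v w d₁ d₂ d₃) :
    τ ∈ LinearMap.range d₁ ↔ ∃ h₁ h₂ h₃, h = u • h₁ + v • h₂ + w • h₃ := by
  obtain ⟨s₁, s₂, s₃, a₁, a₂, a₃, t₁, t₂, t₃, e₁, e₂, e₃, hh⟩ := hτ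
  simp only at t₁ t₂ t₃ hh
  constructor
  · rintro ⟨σ, rfl⟩
    have lift : ∀ (c : R) (s : F₁), c • d₁ σ = d₁ s → ∃ b, s = c • σ + d₂ b := by
      intro c s hs
      obtain ⟨b, hb⟩ := (h₁ (s - c • σ)).mp (by rw [map_sub, map_smul, hs, sub_self])
      exact ⟨b, by rw [hb]; abel⟩
    obtain ⟨b₁, rfl⟩ := lift _ _ t₁
    obtain ⟨b₂, rfl⟩ := lift _ _ t₂
    obtain ⟨b₃, rfl⟩ := lift _ _ t₃
    obtain ⟨k₁, hk₁⟩ := (h₂ (a₁ - (w • b₂ - v • b₃))).mp (by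
      rw [map_sub, map_sub, map_smul, map_smul, ← e₁]; module)
    obtain ⟨k₂, hk₂⟩ := (h₂ (a₂ - (u • b₃ - w • b₁))).mp (by
      rw [map_sub, map_sub, map_smul, map_smul, ← e₂]; module)
    obtain ⟨k₃, hk₃⟩ := (h₂ (a₃ - (v • b₁ - u • b₂))).mp (by
      rw [map_sub, map_sub, map_smul, map_smul, ← e₃]; module)
    refine ⟨k₁, k₂, k₃, h₃ ?_⟩
    rw [hh, map_add, map_add, map_smul, map_smul, map_smul, hk₁, hk₂, hk₃]
    module
  · rintro ⟨k₁, k₂, k₃, rfl⟩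
    obtain ⟨b₁, b₂, b₃, f₁, f₂, f₃⟩ := hF₂.koszul_one (m₁ := a₁ - d₃ k₁) (m₂ := a₂ - d₃ k₂)
      (m₃ := a₃ - d₃ k₃) (by
        rw [map_add, map_add, map_smul, map_smul, map_smul] at hh
        linear_combination (norm := module) -hh)
    have dd : ∀ (m : F₂) (k : F₃), d₂ (m - d₃ k) = d₂ m := fun m k => by
      rw [map_sub, h₂.apply_apply_eq_zero, sub_zero]
    have g₂ := dd a₂ k₂
    have g₃ := dd a₃ k₃
    rw [f₂, ← e₂, map_sub, map_smul, map_smul] at g₂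
    rw [f₃, ← e₃, map_sub, map_smul, map_smul] at g₃
    obtain ⟨σ, hσ, -⟩ := hF₁.koszul_two (m₁ := s₁ - d₂ b₁) (m₂ := s₂ - d₂ b₂) (m₃ := s₃ - d₂ b₃)
      (by linear_combination (norm := module) -g₃) (by linear_combination (norm := module) g₂)
    refine ⟨σ, hF₀.cancel ?_⟩
    rw [t₁, ← map_smul, ← hσ, map_sub, h₁.apply_apply_eq_zero, sub_zero]

lemma smul_mem_range_of_mem_residueRelation {τ : F₀} {h : F₃}
    (hτ : (τ, h) ∈ residueRelation u v w d₁ d₂ d₃) : u • τ ∈ LinearMap.range d₁ ∧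
      v • τ ∈ LinearMap.range d₁ ∧ w • τ ∈ LinearMap.range d₁ := by
  obtain ⟨s₁, s₂, s₃, a₁, a₂, a₃, t₁, t₂, t₃, -⟩ := hτ
  exact ⟨⟨s₁, t₁.symm⟩, ⟨s₂, t₂.symm⟩, ⟨s₃, t₃.symm⟩⟩

lemma exists_eq_of_mem_residueRelation {τ : F₀} {h : F₃}
    (hτ : (τ, h) ∈ residueRelation u v w d₁ d₂ d₃) :
    ∃ a₁ a₂ a₃, d₃ h = u • a₁ + v • a₂ + w • a₃ := by
  obtain ⟨s₁, s₂, s₃, a₁, a₂, a₃, t₁, t₂, t₃, e₁, e₂, e₃, hh⟩ := hτ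
  exact ⟨a₁, a₂, a₃, hh⟩

/-- A linear relation matching two pairs of submodules identifies the quotients. -/
lemma length_eq_of_relation {M N : Type*} [AddCommGroup M] [Module R M] [AddCommGroup N]
    [Module R N] (Γ : Submodule R (M × N)) {M₀ M₁ : Submodule R M} {N₀ N₁ : Submodule R N}
    (hM : ∀ m ∈ M₁, ∃ n, (m, n) ∈ Γ) (hN : ∀ n ∈ N₁, ∃ m, (m, n) ∈ Γ)
    (hΓ : ∀ m n, (m, n) ∈ Γ → m ∈ M₁ ∧ n ∈ N₁) (h₀ : ∀ m n, (m, n) ∈ Γ → (m ∈ M₀ ↔ n ∈ N₀)) :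
    Module.length R (M₁ ⧸ M₀.submoduleOf M₁) = Module.length R (N₁ ⧸ N₀.submoduleOf N₁) := by
  let f : Γ →ₗ[R] M₁ ⧸ M₀.submoduleOf M₁ := (M₀.submoduleOf M₁).mkQ ∘ₗ
    ((LinearMap.fst R M N ∘ₗ Γ.subtype).codRestrict M₁ fun t => (hΓ _ _ t.2).1)
  let g : Γ →ₗ[R] N₁ ⧸ N₀.submoduleOf N₁ := (N₀.submoduleOf N₁).mkQ ∘ₗ
    ((LinearMap.snd R M N ∘ₗ Γ.subtype).codRestrict N₁ fun t => (hΓ _ _ t.2).2)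
  have hf : Function.Surjective f := by
    intro q
    obtain ⟨⟨m, hm⟩, rfl⟩ := Submodule.mkQ_surjective _ q
    obtain ⟨n, hn⟩ := hM m hm
    exact ⟨⟨(m, n), hn⟩, rfl⟩
  have hg : Function.Surjective g := by
    intro q
    obtain ⟨⟨n, hn⟩, rfl⟩ := Submodule.mkQ_surjective _ q
    obtain ⟨m, hm⟩ := hN n hn
    exact ⟨⟨(m, n), hm⟩, rfl⟩
  have hk : LinearMap.ker f = LinearMap.ker g := by
    ext ⟨⟨m, n⟩, h⟩
    simp only [f, g, LinearMap.mem_ker, LinearMap.comp_apply, Submodule.mkQ_apply,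
      Submodule.Quotient.mk_eq_zero]
    exact h₀ m n h
  rw [← (f.quotKerEquivOfSurjective hf).length_eq, ← (g.quotKerEquivOfSurjective hg).length_eq, hk]

end ResidueRelation

/-! ### The free resolution of the cube of the ideal of minors. -/

namespace TernaryForms

open MvPolynomial

variable {R : Type*} [CommRing R] {x y z p q w : R}

lemma exists_eq_linearForm {s : MvPolynomial (Fin 3) R} (hs : s.IsHomogeneous 1) :
    ∃ h : Fin 3 → R, s = linearForm (h 0) (h 1) (h 2) := by
  rw [← mem_homogeneousSubmodule, homogeneousSubmodule_one_eq_span_X,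
    Submodule.mem_span_range_iff_exists_fun] at hs
  obtain ⟨h, rfl⟩ := hs
  exact ⟨h, by simp [Fin.sum_univ_three, linearForm, smul_eq_C_mul]⟩

lemma eval_linearForm (x y z : R) (a : Fin 3 → R) :
    eval a (linearForm x y z) = x * a 0 + y * a 1 + z * a 2 := by
  simp [linearForm]

lemma linearForm_injective {h k : Fin 3 → R}
    (e : linearForm (h 0) (h 1) (h 2) = linearForm (k 0) (k 1) (k 2)) : h = k := by
  ext i
  have := congrArg (eval (Pi.single i 1)) e
  rw [eval_linearForm, eval_linearForm] at this
  fin_cases i <;> simpa using this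

/-- The coefficients of the product of the linear forms with coefficients `x, y, z` and `h` lie
in `J`. -/
structure ProductMem (J : Ideal R) (x y z : R) (h : Fin 3 → R) : Prop where
  c00 : x * h 0 ∈ J
  c01 : y * h 0 + x * h 1 ∈ J
  c02 : z * h 0 + x * h 2 ∈ J
  c11 : y * h 1 ∈ J
  c12 : z * h 1 + y * h 2 ∈ J
  c22 : z * h 2 ∈ J

lemma productMem_iff {u v t : R} {h : Fin 3 → R} :
    ProductMem (Ideal.span {u, v, t}) x y z h ↔
      ∃ a₁ a₂ a₃ : homogeneousSubmodule (Fin 3) R 2,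
        linearForm x y z * linearForm (h 0) (h 1) (h 2) =
          u • (a₁ : MvPolynomial (Fin 3) R) + v • (a₂ : MvPolynomial (Fin 3) R) +
            t • (a₃ : MvPolynomial (Fin 3) R) := by
  set J := Ideal.span {u, v, t} with hJ
  constructor
  · intro H
    have hmap : J.map C = Ideal.span {C u, C v, (C t : MvPolynomial (Fin 3) R)} := by
      rw [hJ, Ideal.map_span, Set.image_insert_eq, Set.image_pair]
    have hmem : linearForm x y z * linearForm (h 0) (h 1) (h 2) ∈ J.map C := by
      have : linearForm x y z * linearForm (h 0) (h 1) (h 2) =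
          X 0 * X 0 * C (x * h 0) + X 0 * X 1 * C (y * h 0 + x * h 1) +
          X 0 * X 2 * C (z * h 0 + x * h 2) + X 1 * X 1 * C (y * h 1) +
          X 1 * X 2 * C (z * h 1 + y * h 2) + X 2 * X 2 * C (z * h 2) := by
        simp only [linearForm, C_mul, C_add]; ring
      rw [this]
      have key : ∀ {m : MvPolynomial (Fin 3) R} {c : R}, c ∈ J → m * C c ∈ J.map C := fun hc =>
        Ideal.mul_mem_left _ _ (Ideal.mem_map_of_mem C hc)
      exact add_mem (add_mem (add_mem (add_mem (add_mem (key H.c00) (key H.c01)) (key H.c02))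
        (key H.c11)) (key H.c12)) (key H.c22)
    rw [hmap] at hmem
    obtain ⟨a, b, c, habc⟩ := Submodule.mem_span_triple.mp hmem
    refine ⟨⟨_, homogeneousComponent_mem 2 a⟩, ⟨_, homogeneousComponent_mem 2 b⟩,
      ⟨_, homogeneousComponent_mem 2 c⟩, ?_⟩
    have hom : (linearForm x y z * linearForm (h 0) (h 1) (h 2)).IsHomogeneous 2 :=
      (linearForm_isHomogeneous x y z).mul (linearForm_isHomogeneous _ _ _)
    rw [← homogeneousComponent_eq_self hom, ← habc]
    simp only [smul_eq_mul, map_add, mul_comm _ (C _), homogeneousComponent_C_mul, smul_eq_C_mul]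
  · rintro ⟨a₁, a₂, a₃, H⟩
    -- The coefficients are recovered by polarization: the values at the unit vectors and at their
    -- pairwise sums suffice.
    have key : ∀ b : Fin 3 → R, (x * b 0 + y * b 1 + z * b 2) *
        (h 0 * b 0 + h 1 * b 1 + h 2 * b 2) ∈ J := by
      intro b
      have := congrArg (eval b) H
      rw [map_mul, eval_linearForm, eval_linearForm] at this
      rw [this, map_add, map_add, smul_eval, smul_eval, smul_eval]
      exact add_mem (add_mem (J.mul_mem_right _ (Ideal.subset_span (by simp)))
        (J.mul_mem_right _ (Ideal.subset_span (by simp))))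
        (J.mul_mem_right _ (Ideal.subset_span (by simp)))
    have k0 : x * h 0 ∈ J := by simpa using key ![1, 0, 0]
    have k1 : y * h 1 ∈ J := by simpa using key ![0, 1, 0]
    have k2 : z * h 2 ∈ J := by simpa using key ![0, 0, 1]
    have k01 : (x + y) * (h 0 + h 1) ∈ J := by simpa using key ![1, 1, 0]
    have k02 : (x + z) * (h 0 + h 2) ∈ J := by simpa using key ![1, 0, 1]
    have k12 : (y + z) * (h 1 + h 2) ∈ J := by simpa using key ![0, 1, 1]
    refine ⟨k0, ?_, ?_, k1, ?_, k2⟩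
    · convert sub_mem (sub_mem k01 k0) k1 using 1; ring
    · convert sub_mem (sub_mem k02 k0) k2 using 1; ring
    · convert sub_mem (sub_mem k12 k1) k2 using 1; ring

/-- Multiplication by a form of degree one. -/
noncomputable def mulForm (x y z : R) (n : ℕ) :
    homogeneousSubmodule (Fin 3) R n →ₗ[R] homogeneousSubmodule (Fin 3) R (1 + n) :=
  (LinearMap.mulLeft R (linearForm x y z)).restrict fun _ hs =>
    (linearForm_isHomogeneous x y z).mul hs

@[simp] lemma coe_mulForm (x y z : R) (n : ℕ) (s : homogeneousSubmodule (Fin 3) R n) :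
    (mulForm x y z n s : MvPolynomial (Fin 3) R) = linearForm x y z * s := rfl

/-- Linear forms in terms of their coefficients. -/
noncomputable def ofCoeffs : (Fin 3 → R) →ₗ[R] homogeneousSubmodule (Fin 3) R 1 where
  toFun h := ⟨linearForm (h 0) (h 1) (h 2), linearForm_isHomogeneous _ _ _⟩
  map_add' h k := Subtype.ext (by simp [linearForm]; ring)
  map_smul' r h := Subtype.ext (by simp [linearForm, smul_eq_C_mul]; ring)

@[simp] lemma coe_ofCoeffs (h : Fin 3 → R) :
    (ofCoeffs h : MvPolynomial (Fin 3) R) = linearForm (h 0) (h 1) (h 2) := rfl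

/-- The third differential of the free resolution of the cube of the ideal of maximal minors. -/
noncomputable def diffThree (x y z p q w : R) : (Fin 3 → R) →ₗ[R]
    homogeneousSubmodule (Fin 3) R 2 × homogeneousSubmodule (Fin 3) R 2 :=
  ((mulForm p q w 1).prod (-mulForm x y z 1)) ∘ₗ ofCoeffs

/-- The second differential of the same resolution. -/
noncomputable def diffTwo (x y z p q w : R) :
    homogeneousSubmodule (Fin 3) R 2 × homogeneousSubmodule (Fin 3) R 2 →ₗ[R]
      homogeneousSubmodule (Fin 3) R 3 :=
  (mulForm x y z 2).coprod (mulForm p q w 2)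

/-- The first differential of the same resolution. -/
noncomputable def diffOne (x y z p q w : R) : homogeneousSubmodule (Fin 3) R 3 →ₗ[R] R :=
  (aeval ![y * w - z * q, z * p - x * w, x * q - y * p]).toLinearMap ∘ₗ Submodule.subtype _

/-- The ideal of maximal minors of the matrix with rows `x, y, z` and `p, q, w`. -/
def minors (x y z p q w : R) : Ideal R :=
  Ideal.span (Set.range ![y * w - z * q, z * p - x * w, x * q - y * p])

lemma range_diffOne (x y z p q w : R) : LinearMap.range (diffOne x y z p q w) =
    minors x y z p q w ^ 3 := by
  ext r
  rw [minors, Ideal.mem_span_pow_iff_exists_isHomogeneous, LinearMap.mem_range]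
  constructor
  · rintro ⟨⟨s, hs⟩, rfl⟩
    exact ⟨s, hs, rfl⟩
  · rintro ⟨s, hs, rfl⟩
    exact ⟨⟨s, hs⟩, rfl⟩

namespace RegularMatrix

lemma injective_diffThree (h : RegularMatrix x y z p q w) :
    Function.Injective (diffThree x y z p q w) := by
  rw [← LinearMap.ker_eq_bot, LinearMap.ker_eq_bot']
  intro k hk
  have := congrArg (fun t => (t.2 : MvPolynomial (Fin 3) R)) hk
  simp only [diffThree, LinearMap.comp_apply, LinearMap.prod_apply, Function.prod_apply,
    LinearMap.neg_apply,
    Submodule.coe_neg, coe_mulForm, coe_ofCoeffs, Prod.snd_zero, Submodule.coe_zero,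
    neg_eq_zero] at this
  have := h.linearForm_mul_eq_zero this
  exact linearForm_injective (by rw [this]; simp [linearForm])

lemma exact_diffThree (h : RegularMatrix x y z p q w) :
    Function.Exact (diffThree x y z p q w) (diffTwo x y z p q w) := by
  rintro ⟨⟨s, hs⟩, ⟨t, ht⟩⟩
  constructor
  · intro e
    have e := congrArg Subtype.val e
    obtain ⟨r, hr, rfl, rfl⟩ := h.exists_isHomogeneous_of_mul_add_mul_eq_zero (n := 1) hs ht e
    obtain ⟨k, rfl⟩ := exists_eq_linearForm hr
    exact ⟨k, rfl⟩
  · rintro ⟨k, hk⟩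
    rw [← hk]
    apply Subtype.ext
    simp only [diffThree, diffTwo, LinearMap.comp_apply, LinearMap.prod_apply, Function.prod_apply,
      LinearMap.neg_apply, LinearMap.coprod_apply, Submodule.coe_neg, Submodule.coe_add,
      coe_mulForm, coe_ofCoeffs, Submodule.coe_zero]
    ring

lemma exact_diffTwo (h : RegularMatrix x y z p q w) :
    Function.Exact (diffTwo x y z p q w) (diffOne x y z p q w) := by
  rintro ⟨s, hs⟩
  constructor
  · intro e
    obtain ⟨α, β, hα, hβ, rfl⟩ := h.exists_of_eval_eq_zero (n := 2) hs e
    exact ⟨(⟨α, hα⟩, ⟨β, hβ⟩), rfl⟩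
  · rintro ⟨⟨α, β⟩, hk⟩
    rw [← hk]
    change eval _ (linearForm x y z * (α : MvPolynomial (Fin 3) R) +
      linearForm p q w * (β : MvPolynomial (Fin 3) R)) = 0
    rw [map_add, map_mul, map_mul, eval_linearForm, eval_linearForm]
    simp only [Matrix.cons_val_zero, Matrix.cons_val_one, Matrix.cons_val]
    ring

end RegularMatrix

/-- The residue relation of the cube of the ideal of maximal minors. -/
noncomputable def cubeRelation (x y z p q w u v t : R) : Submodule R (R × (Fin 3 → R)) :=
  residueRelation u v t (diffOne x y z p q w) (diffTwo x y z p q w) (diffThree x y z p q w)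

lemma diffThree_eq_iff {u v t : R} {h : Fin 3 → R} :
    (∃ a₁ a₂ a₃, diffThree x y z p q w h = u • a₁ + v • a₂ + t • a₃) ↔
      ProductMem (Ideal.span {u, v, t}) x y z h ∧ ProductMem (Ideal.span {u, v, t}) p q w h := by
  rw [productMem_iff, productMem_iff]
  constructor
  · rintro ⟨a₁, a₂, a₃, H⟩
    have H1 := congrArg (fun t => (t.1 : MvPolynomial (Fin 3) R)) H
    have H2 := congrArg (fun t => (t.2 : MvPolynomial (Fin 3) R)) H
    simp only [diffThree, LinearMap.comp_apply, LinearMap.prod_apply, Function.prod_apply,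
      LinearMap.neg_apply,
      Submodule.coe_neg, coe_mulForm, coe_ofCoeffs, Prod.snd_add, Prod.fst_add, Prod.smul_fst,
      Prod.smul_snd, Submodule.coe_add, Submodule.coe_smul] at H1 H2
    refine ⟨⟨-a₁.2, -a₂.2, -a₃.2, ?_⟩, ⟨a₁.1, a₂.1, a₃.1, H1⟩⟩
    simp only [Submodule.coe_neg]
    rw [neg_eq_iff_eq_neg] at H2
    rw [H2]
    module
  · rintro ⟨⟨a₁, a₂, a₃, H2⟩, ⟨b₁, b₂, b₃, H1⟩⟩
    refine ⟨(b₁, -a₁), (b₂, -a₂), (b₃, -a₃), Prod.ext (Subtype.ext H1) (Subtype.ext ?_)⟩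
    simp only [diffThree, LinearMap.comp_apply, LinearMap.prod_apply, Function.prod_apply,
      LinearMap.neg_apply,
      Submodule.coe_neg, coe_mulForm, coe_ofCoeffs, Prod.snd_add, Prod.smul_snd,
      Submodule.coe_add, Submodule.coe_smul, H2]
    module

namespace RegularMatrix

variable {u v t : R}

lemma exists_mem_cubeRelation_left (h : RegularMatrix x y z p q w) {τ : R}
    (hu : u * τ ∈ minors x y z p q w ^ 3) (hv : v * τ ∈ minors x y z p q w ^ 3)
    (ht : t * τ ∈ minors x y z p q w ^ 3) :
    ∃ k, (τ, k) ∈ cubeRelation x y z p q w u v t := by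
  rw [← range_diffOne] at hu hv ht
  exact exists_mem_residueRelation_of_smul_mem h.exact_diffTwo h.exact_diffThree hu hv ht

lemma exists_mem_cubeRelation_right (h : RegularMatrix x y z p q w) (hr : RegTriple u v t R)
    {k : Fin 3 → R} (h₁ : ProductMem (Ideal.span {u, v, t}) x y z k)
    (h₂ : ProductMem (Ideal.span {u, v, t}) p q w k) :
    ∃ τ, (τ, k) ∈ cubeRelation x y z p q w u v t := by
  obtain ⟨a₁, a₂, a₃, H⟩ := (diffThree_eq_iff (u := u) (v := v) (t := t)).mpr ⟨h₁, h₂⟩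
  exact exists_mem_residueRelation_of_eq h.exact_diffTwo h.exact_diffThree hr
    (hr.homogeneousSubmodule _ _) H

lemma mul_mem_of_mem_cubeRelation {τ : R} {k : Fin 3 → R}
    (hk : (τ, k) ∈ cubeRelation x y z p q w u v t) :
    u * τ ∈ minors x y z p q w ^ 3 ∧ v * τ ∈ minors x y z p q w ^ 3 ∧
      t * τ ∈ minors x y z p q w ^ 3 := by
  rw [← range_diffOne]
  exact smul_mem_range_of_mem_residueRelation hk

lemma productMem_of_mem_cubeRelation {τ : R} {k : Fin 3 → R}
    (hk : (τ, k) ∈ cubeRelation x y z p q w u v t) :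
    ProductMem (Ideal.span {u, v, t}) x y z k ∧ ProductMem (Ideal.span {u, v, t}) p q w k :=
  diffThree_eq_iff.mp (exists_eq_of_mem_residueRelation hk)

lemma mem_cube_iff_of_mem_cubeRelation (h : RegularMatrix x y z p q w) (hr : RegTriple u v t R)
    {τ : R} {k : Fin 3 → R} (hk : (τ, k) ∈ cubeRelation x y z p q w u v t) :
    τ ∈ minors x y z p q w ^ 3 ↔ ∀ i, k i ∈ Ideal.span {u, v, t} := by
  rw [← range_diffOne, mem_range_iff_of_mem_residueRelation h.exact_diffTwo h.exact_diffThree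
    h.injective_diffThree hr (hr.homogeneousSubmodule _ _)
    ((hr.homogeneousSubmodule _ _).prod (hr.homogeneousSubmodule _ _)) hk]
  simp only [Submodule.mem_span_triple]
  constructor
  · rintro ⟨a, b, c, rfl⟩ i
    exact ⟨a i, b i, c i, by simp [mul_comm]⟩
  · intro H
    choose a b c habc using H
    refine ⟨a, b, c, funext fun i => ?_⟩
    rw [← habc i]
    simp [mul_comm]

end RegularMatrix

end TernaryForms

/-! ### Lengths of subquotients. -/

section Length

variable {R M : Type*} [CommRing R] [AddCommGroup M] [Module R M]

lemma length_quotient_submoduleOf_add {L₀ L₁ L₂ : Submodule R M} (h₀ : L₀ ≤ L₁) (h₁ : L₁ ≤ L₂) :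
    Module.length R (L₂ ⧸ L₀.submoduleOf L₂) =
      Module.length R (L₁ ⧸ L₀.submoduleOf L₁) + Module.length R (L₂ ⧸ L₁.submoduleOf L₂) := by
  have e₁ : L₀.submoduleOf L₁ ≤ (L₀.submoduleOf L₂).comap (Submodule.inclusion h₁) := fun _ h => h
  have e₂ : L₀.submoduleOf L₂ ≤ (L₁.submoduleOf L₂).comap LinearMap.id := fun _ h => h₀ h
  refine Module.length_eq_add_of_exact (Submodule.mapQ _ _ (Submodule.inclusion h₁) e₁)
    (Submodule.mapQ _ _ LinearMap.id e₂) ?_ ?_ ?_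
  · rw [← LinearMap.ker_eq_bot, LinearMap.ker_eq_bot']
    intro a ha
    obtain ⟨a, rfl⟩ := Submodule.mkQ_surjective _ a
    simp only [Submodule.mkQ_apply, Submodule.mapQ_apply, Submodule.Quotient.mk_eq_zero] at ha ⊢
    exact ha
  · intro a
    obtain ⟨a, rfl⟩ := Submodule.mkQ_surjective _ a
    exact ⟨Submodule.Quotient.mk a, rfl⟩
  · intro a
    obtain ⟨a, rfl⟩ := Submodule.mkQ_surjective _ a
    simp only [Submodule.mkQ_apply, Submodule.mapQ_apply, LinearMap.id_apply,
      Submodule.Quotient.mk_eq_zero]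
    constructor
    · intro h
      exact ⟨Submodule.Quotient.mk ⟨a, h⟩, rfl⟩
    · rintro ⟨b, hb⟩
      obtain ⟨b, rfl⟩ := Submodule.mkQ_surjective _ b
      simp only [Submodule.mkQ_apply, Submodule.mapQ_apply] at hb
      rw [Submodule.Quotient.eq] at hb
      have h := h₀ hb
      change (b : M) - a ∈ L₁ at h
      change (a : M) ∈ L₁
      simpa using sub_mem b.2 h

/-- The hypotheses say that `θ` induces an isomorphism of `(R/Q)^ι` with `K/L`; it is applied once
to each layer of the filtration. -/
lemma length_quotient_submoduleOf_of_linearMap {ι : Type*} [Fintype ι] (Q : Ideal R)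
    (θ : (ι → R) →ₗ[R] M) {L K : Submodule R M} (hK : ∀ s, θ s ∈ K)
    (hs : ∀ k ∈ K, ∃ s, k - θ s ∈ L) (hL : ∀ s, θ s ∈ L ↔ ∀ i, s i ∈ Q) :
    Module.length R (K ⧸ L.submoduleOf K) = Fintype.card ι * Module.length R (R ⧸ Q) := by
  let f : (ι → R) →ₗ[R] K ⧸ L.submoduleOf K := (L.submoduleOf K).mkQ ∘ₗ θ.codRestrict K hK
  have hf : Function.Surjective f := by
    intro k
    obtain ⟨k, rfl⟩ := Submodule.mkQ_surjective _ k
    obtain ⟨s, hs⟩ := hs k k.2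
    refine ⟨s, ?_⟩
    simp only [f, LinearMap.comp_apply, Submodule.mkQ_apply]
    rw [eq_comm, Submodule.Quotient.eq]
    exact hs
  have hker : LinearMap.ker f = Submodule.pi Set.univ fun _ : ι => (Q : Submodule R R) := by
    ext s
    simp only [f, LinearMap.mem_ker, LinearMap.comp_apply, Submodule.mkQ_apply,
      Submodule.Quotient.mk_eq_zero, Submodule.mem_pi, Set.mem_univ, forall_true_left]
    exact hL s
  classical
  rw [← (f.quotKerEquivOfSurjective hf).length_eq, hker,
    (Submodule.quotientPi fun _ : ι => (Q : Submodule R R)).length_eq,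
    Module.length_pi_of_fintype]
  simp

end Length

/-! ### Linear forms annihilated by `x A + y B + z C` modulo powers of `x, y, z`. -/

namespace TernaryForms

variable {R : Type*} [CommRing R] {x y z : R}

/-- All powers of `x, y, z` form regular sequences, in any order. -/
structure PowerRegular (x y z : R) : Prop where
  xyz : ∀ a b c : ℕ, 0 < a → 0 < b → 0 < c → RegTriple (x ^ a) (y ^ b) (z ^ c) R
  xzy : ∀ a b c : ℕ, 0 < a → 0 < b → 0 < c → RegTriple (x ^ a) (z ^ c) (y ^ b) R
  yzx : ∀ a b c : ℕ, 0 < a → 0 < b → 0 < c → RegTriple (y ^ b) (z ^ c) (x ^ a) R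

lemma _root_.RegTriple.exists_eq {u v r m a b c : R} (h : RegTriple u v r R)
    (e : r * m = a * u + b * v + r * c) : ∃ a' b', m = a' * u + b' * v + c := by
  obtain ⟨n₁, n₂, hn⟩ := h.thd (m - c) a b (by simp only [smul_eq_mul]; linear_combination e)
  exact ⟨n₁, n₂, by simp only [smul_eq_mul] at hn; linear_combination hn⟩

/-- Each quadratic monomial times `h i` is a combination of the six coefficients. Halving occurs
only for the product of the two variables other than the `i`-th, as in `2yz h₀ = y (z h₀ + x h₂) + z
(y h₀ + x h₁) - x (z h₁ + y h₂)`. -/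
lemma ProductMem.mul_mem {J : Ideal R} {h : Fin 3 → R} (h2 : IsUnit (2 : R))
    (H : ProductMem J x y z h) (i : Fin 3) {κ : R} (hκ : κ ∈ Ideal.span {x, y, z} ^ 2) :
    κ * h i ∈ J := by
  obtain ⟨c00, c01, c02, c11, c12, c22⟩ := H
  have two : ∀ {a : R}, 2 * a ∈ J → a ∈ J := fun ha => (Ideal.unit_mul_mem_iff_mem J h2).mp ha
  have key : x * x * h i ∈ J ∧ x * y * h i ∈ J ∧ x * z * h i ∈ J ∧ y * y * h i ∈ J ∧
      y * z * h i ∈ J ∧ z * z * h i ∈ J := by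
    fin_cases i
    · refine ⟨?_, ?_, ?_, ?_, two ?_, ?_⟩ <;> simp only [Fin.zero_eta]
      · convert J.mul_mem_left x c00 using 1; ring
      · convert J.mul_mem_left y c00 using 1; ring
      · convert J.mul_mem_left z c00 using 1; ring
      · convert sub_mem (J.mul_mem_left y c01) (J.mul_mem_left x c11) using 1; ring
      · convert sub_mem (add_mem (J.mul_mem_left y c02) (J.mul_mem_left z c01))
          (J.mul_mem_left x c12) using 1; ring
      · convert sub_mem (J.mul_mem_left z c02) (J.mul_mem_left x c22) using 1; ring
    · refine ⟨?_, ?_, two ?_, ?_, ?_, ?_⟩ <;> simp only [Fin.mk_one]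
      · convert sub_mem (J.mul_mem_left x c01) (J.mul_mem_left y c00) using 1; ring
      · convert J.mul_mem_left x c11 using 1; ring
      · convert sub_mem (add_mem (J.mul_mem_left x c12) (J.mul_mem_left z c01))
          (J.mul_mem_left y c02) using 1; ring
      · convert J.mul_mem_left y c11 using 1; ring
      · convert J.mul_mem_left z c11 using 1; ring
      · convert sub_mem (J.mul_mem_left z c12) (J.mul_mem_left y c22) using 1; ring
    · refine ⟨?_, two ?_, ?_, ?_, ?_, ?_⟩ <;> simp only [Fin.reduceFinMk]
      · convert sub_mem (J.mul_mem_left x c02) (J.mul_mem_left z c00) using 1; ring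
      · convert sub_mem (add_mem (J.mul_mem_left x c12) (J.mul_mem_left y c02))
          (J.mul_mem_left z c01) using 1; ring
      · convert J.mul_mem_left x c22 using 1; ring
      · convert sub_mem (J.mul_mem_left y c12) (J.mul_mem_left z c11) using 1; ring
      · convert J.mul_mem_left y c22 using 1; ring
      · convert J.mul_mem_left z c22 using 1; ring
  obtain ⟨k1, k2, k3, k4, k5, k6⟩ := key
  have : Ideal.span {x, y, z} ^ 2 ≤ J.colon {h i} := by
    rw [pow_two, Ideal.mul_le]
    intro r hr s hs
    obtain ⟨r₁, r₂, r₃, rfl⟩ := Submodule.mem_span_triple.mp hr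
    obtain ⟨s₁, s₂, s₃, rfl⟩ := Submodule.mem_span_triple.mp hs
    rw [Submodule.mem_colon_singleton]
    simp only [smul_eq_mul]
    have := add_mem (add_mem (add_mem (add_mem (add_mem (J.mul_mem_left (r₁ * s₁) k1)
      (J.mul_mem_left (r₁ * s₂ + r₂ * s₁) k2)) (J.mul_mem_left (r₁ * s₃ + r₃ * s₁) k3))
      (J.mul_mem_left (r₂ * s₂) k4)) (J.mul_mem_left (r₂ * s₃ + r₃ * s₂) k5))
      (J.mul_mem_left (r₃ * s₃) k6)
    convert this using 1
    ring
  simpa using this hκ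

/-- The triples `h` whose product with the linear form `x A + y B + z C` vanishes modulo
`(x ^ 2, y ^ 2, z ^ 2)`. -/
def productKernel (x y z : R) : Submodule R (Fin 3 → R) where
  carrier := {h | ProductMem (Ideal.span {x ^ 2, y ^ 2, z ^ 2}) x y z h}
  zero_mem' := by constructor <;> simp
  add_mem' := by
    rintro h k ⟨a, b, c, d, e, f⟩ ⟨a', b', c', d', e', f'⟩
    constructor <;> simp only [Pi.add_apply]
    · convert add_mem a a' using 1; ring
    · convert add_mem b b' using 1; ring
    · convert add_mem c c' using 1; ring
    · convert add_mem d d' using 1; ring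
    · convert add_mem e e' using 1; ring
    · convert add_mem f f' using 1; ring
  smul_mem' := by
    rintro r h ⟨a, b, c, d, e, f⟩
    constructor <;> simp only [Pi.smul_apply, smul_eq_mul]
    · convert Ideal.mul_mem_left _ r a using 1; ring
    · convert Ideal.mul_mem_left _ r b using 1; ring
    · convert Ideal.mul_mem_left _ r c using 1; ring
    · convert Ideal.mul_mem_left _ r d using 1; ring
    · convert Ideal.mul_mem_left _ r e using 1; ring
    · convert Ideal.mul_mem_left _ r f using 1; ring

/-- Triples with entries in an ideal. -/
abbrev entriesIn (J : Ideal R) : Submodule R (Fin 3 → R) :=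
  Submodule.pi Set.univ fun _ => (J : Submodule R R)

lemma mem_entriesIn {J : Ideal R} {h : Fin 3 → R} : h ∈ entriesIn J ↔ ∀ i, h i ∈ J := by
  simp [Submodule.mem_pi]

/-- The parametrization of `productKernel` modulo the multiples of `x y z`. -/
def kernelParam (x y z : R) : (Fin 3 → R) →ₗ[R] (Fin 3 → R) where
  toFun s := ![x * y * s 0 + x * z * s 1, x * y * s 2 - y * z * s 1, -(x * z * s 2) - y * z * s 0]
  map_add' s t := by
    ext i; fin_cases i <;> simp <;> ring
  map_smul' r s := by
    ext i; fin_cases i <;> simp <;> ring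

namespace PowerRegular

local notation "𝔧" => Ideal.span {x ^ 2, y ^ 2, z ^ 2}

lemma mem_sq {a : R} : a ∈ 𝔧 ↔ ∃ r s t, a = r * x ^ 2 + s * y ^ 2 + t * z ^ 2 := by
  rw [Submodule.mem_span_triple]
  simp only [smul_eq_mul, eq_comm]

lemma mem_lin {a : R} : a ∈ Ideal.span {x, y, z} ↔ ∃ r s t, a = r * x + s * y + t * z := by
  rw [Submodule.mem_span_triple]
  simp only [smul_eq_mul, eq_comm]

/-- Monomial colon ideals behave as in a polynomial ring: the factor is cancelled modulo the other
two generators, as the last member of a suitable regular sequence. -/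
lemma colon_x (H : PowerRegular x y z) {m : R} (hm : x * m ∈ 𝔧) :
    ∃ r s t, m = r * x + s * y ^ 2 + t * z ^ 2 := by
  obtain ⟨r, s, t, h⟩ := mem_sq.mp hm
  obtain ⟨a, b, hab⟩ := (H.yzx 1 2 2 (by simp) (by simp) (by simp)).exists_eq (m := m) (a := s)
    (b := t) (c := x * r) (by linear_combination h)
  exact ⟨r, a, b, by linear_combination hab⟩

lemma colon_y (H : PowerRegular x y z) {m : R} (hm : y * m ∈ 𝔧) :
    ∃ r s t, m = r * x ^ 2 + s * y + t * z ^ 2 := by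
  obtain ⟨r, s, t, h⟩ := mem_sq.mp hm
  obtain ⟨a, b, hab⟩ := (H.xzy 2 1 2 (by simp) (by simp) (by simp)).exists_eq (m := m) (a := r)
    (b := t) (c := y * s) (by linear_combination h)
  exact ⟨a, s, b, by linear_combination hab⟩

lemma colon_z (H : PowerRegular x y z) {m : R} (hm : z * m ∈ 𝔧) :
    ∃ r s t, m = r * x ^ 2 + s * y ^ 2 + t * z := by
  obtain ⟨r, s, t, h⟩ := mem_sq.mp hm
  obtain ⟨a, b, hab⟩ := (H.xyz 2 2 1 (by simp) (by simp) (by simp)).exists_eq (m := m) (a := r)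
    (b := s) (c := z * t) (by linear_combination h)
  exact ⟨a, b, t, by linear_combination hab⟩

lemma colon_xy (H : PowerRegular x y z) {m : R} (hm : x * y * m ∈ 𝔧) :
    ∃ r s t, m = r * x + s * y + t * z ^ 2 := by
  obtain ⟨r, s, t, h⟩ := H.colon_x (m := y * m) (by rwa [← mul_assoc])
  obtain ⟨a, b, hab⟩ := (H.xzy 1 1 2 (by simp) (by simp) (by simp)).exists_eq (m := m) (a := r)
    (b := t) (c := y * s) (by linear_combination h)
  exact ⟨a, s, b, by linear_combination hab⟩

lemma colon_xz (H : PowerRegular x y z) {m : R} (hm : x * z * m ∈ 𝔧) :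
    ∃ r s t, m = r * x + s * y ^ 2 + t * z := by
  obtain ⟨r, s, t, h⟩ := H.colon_x (m := z * m) (by rwa [← mul_assoc])
  obtain ⟨a, b, hab⟩ := (H.xyz 1 2 1 (by simp) (by simp) (by simp)).exists_eq (m := m) (a := r)
    (b := s) (c := z * t) (by linear_combination h)
  exact ⟨a, b, t, by linear_combination hab⟩

lemma colon_yz (H : PowerRegular x y z) {m : R} (hm : y * z * m ∈ 𝔧) :
    ∃ r s t, m = r * x ^ 2 + s * y + t * z := by
  obtain ⟨r, s, t, h⟩ := H.colon_y (m := z * m) (by rwa [← mul_assoc])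
  obtain ⟨a, b, hab⟩ := (H.xyz 2 1 1 (by simp) (by simp) (by simp)).exists_eq (m := m) (a := r)
    (b := s) (c := z * t) (by linear_combination h)
  exact ⟨a, b, t, by linear_combination hab⟩

lemma colon_xyz (H : PowerRegular x y z) {m : R} (hm : x * y * z * m ∈ 𝔧) :
    m ∈ Ideal.span {x, y, z} := by
  obtain ⟨r, s, t, h⟩ := H.colon_xy (m := z * m) (by rwa [← mul_assoc])
  obtain ⟨a, b, hab⟩ := (H.xyz 1 1 1 (by simp) (by simp) (by simp)).exists_eq (m := m) (a := r)
    (b := s) (c := z * t) (by linear_combination h)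
  exact mem_lin.mpr ⟨a, b, t, by linear_combination hab⟩

lemma xyz_mul_mem {m : R} (hm : m ∈ Ideal.span {x, y, z}) : x * y * z * m ∈ 𝔧 := by
  obtain ⟨a, b, c, rfl⟩ := mem_lin.mp hm
  exact mem_sq.mpr ⟨a * y * z, b * x * z, c * x * y, by ring⟩

lemma kernelParam_mem (s : Fin 3 → R) : kernelParam x y z s ∈ productKernel x y z := by
  constructor <;> simp only [kernelParam, LinearMap.coe_mk, AddHom.coe_mk, Matrix.cons_val_zero,
    Matrix.cons_val_one, Matrix.cons_val] <;> rw [mem_sq]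
  · exact ⟨y * s 0 + z * s 1, 0, 0, by ring⟩
  · exact ⟨y * s 2, x * s 0, 0, by ring⟩
  · exact ⟨-z * s 2, 0, x * s 1, by ring⟩
  · exact ⟨0, x * s 2 - z * s 1, 0, by ring⟩
  · exact ⟨0, -z * s 0, -y * s 1, by ring⟩
  · exact ⟨0, 0, -x * s 2 - y * s 0, by ring⟩

/-- The socle-like layer: multiples of `x y z` modulo the squares. -/
def topLayer (x y z : R) : Submodule R (Fin 3 → R) :=
  entriesIn (Ideal.span {x ^ 2, y ^ 2, z ^ 2}) ⊔
    LinearMap.range (LinearMap.lsmul R (Fin 3 → R) (x * y * z))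

lemma mem_topLayer {h : Fin 3 → R} :
    h ∈ topLayer x y z ↔ ∀ i, ∃ t, h i - x * y * z * t ∈ 𝔧 := by
  rw [topLayer, Submodule.mem_sup]
  constructor
  · rintro ⟨a, ha, _, ⟨t, rfl⟩, rfl⟩ i
    exact ⟨t i, by simpa using mem_entriesIn.mp ha i⟩
  · intro H
    choose t ht using H
    exact ⟨fun i => h i - x * y * z * t i, mem_entriesIn.mpr ht, _, ⟨t, rfl⟩, by ext i; simp⟩

lemma length_topLayer (H : PowerRegular x y z) :
    Module.length R (topLayer x y z ⧸ (entriesIn 𝔧).submoduleOf (topLayer x y z)) =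
      3 * Module.length R (R ⧸ Ideal.span {x, y, z}) := by
  have := length_quotient_submoduleOf_of_linearMap (Ideal.span {x, y, z})
    (LinearMap.lsmul R (Fin 3 → R) (x * y * z)) (L := entriesIn 𝔧) (K := topLayer x y z)
    (fun s => mem_topLayer.mpr fun i => ⟨s i, by simp⟩)
    (fun k hk => by
      choose t ht using mem_topLayer.mp hk
      exact ⟨t, mem_entriesIn.mpr fun i => by simpa using ht i⟩)
    (fun s => by
      rw [mem_entriesIn]
      exact forall_congr' fun i => ⟨fun h => H.colon_xyz (by simpa using h),
        fun h => by simpa using xyz_mul_mem h⟩)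
  simpa using this

lemma entriesIn_le_topLayer : entriesIn 𝔧 ≤ topLayer x y z := le_sup_left

lemma mem_productKernel_of_mem_sq {h : Fin 3 → R} (hh : h ∈ entriesIn 𝔧) :
    h ∈ productKernel x y z := by
  rw [mem_entriesIn] at hh
  have k : ∀ (r : R) i, r * h i ∈ 𝔧 := fun r i => Ideal.mul_mem_left _ r (hh i)
  exact ⟨k _ _, add_mem (k _ _) (k _ _), add_mem (k _ _) (k _ _), k _ _, add_mem (k _ _) (k _ _),
    k _ _⟩

lemma topLayer_le : topLayer x y z ≤ productKernel x y z := by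
  refine sup_le (fun h => mem_productKernel_of_mem_sq) ?_
  rintro _ ⟨t, rfl⟩
  constructor <;> simp only [LinearMap.lsmul_apply, Pi.smul_apply, smul_eq_mul] <;> rw [mem_sq]
  · exact ⟨y * z * t 0, 0, 0, by ring⟩
  · exact ⟨y * z * t 1, x * z * t 0, 0, by ring⟩
  · exact ⟨y * z * t 2, 0, x * y * t 0, by ring⟩
  · exact ⟨0, x * z * t 1, 0, by ring⟩
  · exact ⟨0, x * z * t 2, x * y * t 1, by ring⟩
  · exact ⟨0, 0, x * y * t 2, by ring⟩

lemma kernelParam_mem_topLayer_iff (H : PowerRegular x y z) (s : Fin 3 → R) :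
    kernelParam x y z s ∈ topLayer x y z ↔ ∀ i, s i ∈ Ideal.span {x, y, z} := by
  rw [mem_topLayer]
  constructor
  · intro h
    obtain ⟨t, ht⟩ := h 0
    obtain ⟨t', ht'⟩ := h 1
    simp only [kernelParam, LinearMap.coe_mk, AddHom.coe_mk, Matrix.cons_val_zero,
      Matrix.cons_val_one] at ht ht'
    obtain ⟨a, b, c, e⟩ := H.colon_x (m := y * s 0 + z * s 1 - y * z * t) (by
      convert ht using 1; ring)
    obtain ⟨a', b', c', e'⟩ := H.colon_y (m := x * s 2 - z * s 1 - x * z * t') (by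
      convert ht' using 1; ring)
    obtain ⟨k, l, h0⟩ := (H.xzy 1 1 1 (by simp) (by simp) (by simp)).exists_eq (m := s 0)
      (a := a) (b := c * z - s 1) (c := y * b + z * t) (by linear_combination e)
    obtain ⟨k', l', h1⟩ := (H.xyz 1 1 1 (by simp) (by simp) (by simp)).exists_eq (m := s 1)
      (a := a) (b := b * y - s 0) (c := z * c + y * t) (by linear_combination e)
    obtain ⟨k'', l'', h2⟩ := (H.yzx 1 1 1 (by simp) (by simp) (by simp)).exists_eq (m := s 2)
      (a := b') (b := c' * z + s 1) (c := x * a' + z * t') (by linear_combination e')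
    intro i
    rw [mem_lin]
    fin_cases i
    · exact ⟨k, b, l + t, by simp only [Fin.zero_eta]; linear_combination h0⟩
    · exact ⟨k', l' + t, c, by simp only [Fin.mk_one]; linear_combination h1⟩
    · exact ⟨a', k'', l'' + t', by simp only [Fin.reduceFinMk]; linear_combination h2⟩
  · intro h i
    obtain ⟨a, b, c, e0⟩ := mem_lin.mp (h 0)
    obtain ⟨a', b', c', e1⟩ := mem_lin.mp (h 1)
    obtain ⟨a'', b'', c'', e2⟩ := mem_lin.mp (h 2)
    fin_cases i <;> simp only [kernelParam, LinearMap.coe_mk, AddHom.coe_mk, Fin.zero_eta,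
      Fin.mk_one, Fin.reduceFinMk, Matrix.cons_val_zero, Matrix.cons_val_one, Matrix.cons_val,
      mem_sq, e0, e1, e2]
    · exact ⟨c + b', y * a + z * a', x * b, x * c', by ring⟩
    · exact ⟨c'' - a', y * a'', x * b'' - z * b', -y * c', by ring⟩
    · exact ⟨-b'' - a, -z * a'', -z * b, -x * c'' - y * c, by ring⟩

/-- The diagonal coefficients give `h = (x A, y B, z C)` modulo the squares. The mixed ones put `A +
B`, `A + C`, `B + C` in `(x, y, z)`, hence each of `A`, `B`, `C`, as `2` is a unit. Expanding these
and using the mixed coefficients again matches the remaining terms in pairs with opposite signs. -/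
lemma exists_sub_kernelParam_mem (H : PowerRegular x y z) (h2 : IsUnit (2 : R)) {h : Fin 3 → R}
    (hh : h ∈ productKernel x y z) : ∃ s, h - kernelParam x y z s ∈ topLayer x y z := by
  obtain ⟨c00, c01, c02, c11, c12, c22⟩ := hh
  have two : ∀ {a : R}, 2 * a ∈ Ideal.span {x, y, z} → a ∈ Ideal.span {x, y, z} :=
    fun ha => (Ideal.unit_mul_mem_iff_mem _ h2).mp ha
  obtain ⟨A, A1, A2, hA⟩ := H.colon_x c00
  obtain ⟨B1, B, B2, hB⟩ := H.colon_y c11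
  obtain ⟨C1, C2, C, hC⟩ := H.colon_z c22
  have hAB : A + B ∈ Ideal.span {x, y, z} := by
    obtain ⟨r, s, t, e⟩ := H.colon_xy (m := A + B) (by
      rw [hA, hB] at c01
      convert sub_mem c01 (mem_sq.mpr ⟨x * B1, y * A1, y * A2 + x * B2, rfl⟩) using 1; ring)
    exact mem_lin.mpr ⟨r, s, t * z, by linear_combination e⟩
  have hAC : A + C ∈ Ideal.span {x, y, z} := by
    obtain ⟨r, s, t, e⟩ := H.colon_xz (m := A + C) (by
      rw [hA, hC] at c02
      convert sub_mem c02 (mem_sq.mpr ⟨x * C1, z * A1 + x * C2, z * A2, rfl⟩) using 1; ring)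
    exact mem_lin.mpr ⟨r, s * y, t, by linear_combination e⟩
  have hBC : B + C ∈ Ideal.span {x, y, z} := by
    obtain ⟨r, s, t, e⟩ := H.colon_yz (m := B + C) (by
      rw [hB, hC] at c12
      convert sub_mem c12 (mem_sq.mpr ⟨z * B1 + y * C1, y * C2, z * B2, rfl⟩) using 1; ring)
    exact mem_lin.mpr ⟨r * x, s, t, by linear_combination e⟩
  have hA' : A ∈ Ideal.span {x, y, z} := two (by
    convert sub_mem (add_mem hAB hAC) hBC using 1; ring)
  obtain ⟨a0, a1, a2, rfl⟩ := mem_lin.mp hA'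
  obtain ⟨b1, b0, b2, rfl⟩ := mem_lin.mp ((Ideal.add_mem_iff_right _ hA').mp hAB)
  obtain ⟨c1, c2, c0, rfl⟩ := mem_lin.mp ((Ideal.add_mem_iff_right _ hA').mp hAC)
  obtain ⟨u0, u1, u2, hu⟩ := mem_lin.mp (H.colon_xyz (m := a2 + b2) (by
    rw [hA, hB] at c01
    convert sub_mem c01 (mem_sq.mpr ⟨y * a0 + y * b1 + x * B1, x * a1 + x * b0 + y * A1,
      y * A2 + x * B2, rfl⟩) using 1; ring))
  obtain ⟨v0, v1, v2, hv⟩ := mem_lin.mp (H.colon_xyz (m := a1 + c2) (by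
    rw [hA, hC] at c02
    convert sub_mem c02 (mem_sq.mpr ⟨z * a0 + z * c1 + x * C1, z * A1 + x * C2,
      x * a2 + x * c0 + z * A2, rfl⟩) using 1; ring))
  obtain ⟨w0, w1, w2, hw⟩ := mem_lin.mp (H.colon_xyz (m := b1 + c1) (by
    rw [hB, hC] at c12
    convert sub_mem c12 (mem_sq.mpr ⟨z * B1 + y * C1, z * b0 + z * c2 + y * C2,
      y * b2 + y * c0 + z * B2, rfl⟩) using 1; ring))
  -- By `hu`, `hv`, `hw` the coefficients `b2`, `c2`, `c1` are `-a2`, `-a1`, `-b1` modulo `(x, y,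
  -- z)`, so three parameters remain; the errors contribute multiples of `xyz` and elements of the
  -- ideal of squares.
  refine ⟨![a1, a2, b1], mem_topLayer.mpr fun i => ?_⟩
  fin_cases i <;> simp only [kernelParam, LinearMap.coe_mk, AddHom.coe_mk, Fin.zero_eta,
      Fin.mk_one, Fin.reduceFinMk, Matrix.cons_val_zero, Matrix.cons_val_one, Matrix.cons_val,
      Pi.sub_apply, mem_sq]
  · exact ⟨0, a0, A1, A2, by rw [hA]; ring⟩
  · refine ⟨u0, B1, b0 + z * u1, B2 + y * u2, ?_⟩
    rw [hB]; linear_combination y * z * hu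
  · refine ⟨v0 + w1, C1 + z * w0, C2 + z * v1, c0 + y * v2 + x * w2, ?_⟩
    rw [hC]; linear_combination y * z * hv + x * z * hw

/-- The length of the module of triples killed by the linear form `x A + y B + z C` modulo the
squares of `x, y, z`. -/
lemma length_productKernel (H : PowerRegular x y z) (h2 : IsUnit (2 : R)) :
    Module.length R (productKernel x y z ⧸ (entriesIn 𝔧).submoduleOf (productKernel x y z)) =
      6 * Module.length R (R ⧸ Ideal.span {x, y, z}) := by
  have := length_quotient_submoduleOf_of_linearMap (Ideal.span {x, y, z})
    (kernelParam x y z) (L := topLayer x y z) (K := productKernel x y z) kernelParam_mem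
    (fun k hk => H.exists_sub_kernelParam_mem h2 hk) H.kernelParam_mem_topLayer_iff
  rw [length_quotient_submoduleOf_add entriesIn_le_topLayer topLayer_le, H.length_topLayer, this,
    Fintype.card_fin, Nat.cast_ofNat, ← add_mul]
  norm_num

end PowerRegular

end TernaryForms

/-! ### Symbolic powers of ideals of dimension one. -/

section SymbolicPowers

variable {R : Type*} [CommRing R]

lemma mem_symbolicPower_iff {I : Ideal R} {n : ℕ} {r : R} :
    r ∈ symbolicPower I n ↔ ∀ P ∈ I.minimalPrimes, ∃ s ∉ P, s * r ∈ I ^ n := by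
  simp only [symbolicPower, Ideal.mem_iInf, Ideal.mem_comap, Subtype.forall]
  refine forall₂_congr fun P hP => ?_
  have : P.IsPrime := hP.1.1
  rw [IsLocalization.algebraMap_mem_map_algebraMap_iff P.primeCompl]
  simp only [Ideal.mem_primeCompl_iff]

variable [IsLocalRing R] [IsNoetherianRing R]

/-- If an ideal becomes primary to the maximal ideal after adding `x`, then all primes above it
that avoid `x` are minimal over it. -/
lemma mem_minimalPrimes_of_notMem {I : Ideal R} {x : R} (hx : x ∈ maximalIdeal R)
    (hI : ∀ P : Ideal R, P.IsPrime → I ≤ P → x ∈ P → P = maximalIdeal R)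
    {P : Ideal R} (hP : P.IsPrime) (hIP : I ≤ P) (hxP : x ∉ P) : P ∈ I.minimalPrimes := by
  obtain ⟨p, hp, hpP⟩ := Ideal.exists_minimalPrimes_le hIP
  suffices p = P from this ▸ hp
  have : p.IsPrime := hp.1.1
  have hm : maximalIdeal R ∈ (p ⊔ Ideal.span {x}).minimalPrimes := by
    refine ⟨⟨inferInstance, sup_le (hpP.trans (le_maximalIdeal hP.ne_top))
      (by rwa [Ideal.span_singleton_le_iff_mem])⟩, fun q hq _ => ?_⟩
    obtain ⟨hq, hpq⟩ := hq
    rw [sup_le_iff, Ideal.span_singleton_le_iff_mem] at hpq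
    exact (hI q hq (hp.1.2.trans hpq.1) hpq.2).ge
  -- Krull's principal ideal theorem in `R/p`: the maximal ideal has height at most one there, so
  -- the smaller prime `P/p` is zero.
  have hh := Ideal.map_height_le_one_of_mem_minimalPrimes hm
  have hker : RingHom.ker (Ideal.Quotient.mk p) ≤ maximalIdeal R := by
    rw [Ideal.mk_ker]; exact hpP.trans (le_maximalIdeal hP.ne_top)
  have hkerP : RingHom.ker (Ideal.Quotient.mk p) ≤ P := by rwa [Ideal.mk_ker]
  have : ((maximalIdeal R).map (Ideal.Quotient.mk p)).IsPrime :=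
    Ideal.map_isPrime_of_surjective Ideal.Quotient.mk_surjective hker
  have hPp : (P.map (Ideal.Quotient.mk p)).IsPrime :=
    Ideal.map_isPrime_of_surjective Ideal.Quotient.mk_surjective hkerP
  have comapP : (P.map (Ideal.Quotient.mk p)).comap (Ideal.Quotient.mk p) = P := by
    rw [Ideal.comap_map_of_surjective _ Ideal.Quotient.mk_surjective]
    exact sup_eq_left.mpr hkerP
  have hlt : P.map (Ideal.Quotient.mk p) < (maximalIdeal R).map (Ideal.Quotient.mk p) := by
    refine lt_of_le_of_ne (Ideal.map_mono (le_maximalIdeal hP.ne_top)) fun h => hxP ?_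
    rw [← comapP, h]
    exact Ideal.mem_map_of_mem _ hx
  have h0 := Ideal.height_le_iff.mp hh _ hPp hlt
  rw [Nat.cast_one, Order.lt_one_iff, Ideal.height_eq_zero_iff_eq_bot] at h0
  rw [← comapP, h0, ← RingHom.ker_eq_comap_bot, Ideal.mk_ker]

/-- Elements of the symbolic power of an ideal of dimension one are multiplied into the ordinary
power by powers of all elements of the maximal ideal. -/
lemma exists_pow_mul_mem_of_mem_symbolicPower {I : Ideal R} {x : R} (hx : x ∈ maximalIdeal R)
    (hI : ∀ P : Ideal R, P.IsPrime → I ≤ P → x ∈ P → P = maximalIdeal R)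
    {n : ℕ} {r : R} (hr : r ∈ symbolicPower I n) {t : R} (ht : t ∈ maximalIdeal R) :
    ∃ k, t ^ k * r ∈ I ^ n := by
  rw [mem_symbolicPower_iff] at hr
  -- A prime over `I ^ n : r` contains `I`, so it is maximal or minimal over `I`. The second case is
  -- impossible, since some `s` outside that prime multiplies `r` into `I ^ n`.
  have : t ∈ ((I ^ n).colon {r}).radical := by
    rw [Ideal.radical_eq_sInf, Ideal.mem_sInf]
    rintro P ⟨hP, hPr⟩
    have hIP : I ≤ P := by
      refine hPr.le_of_pow_le (n := n) ?_
      exact fun a ha => hP (by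
        rw [Submodule.mem_colon_singleton]; exact Ideal.mul_mem_right _ _ ha)
    by_cases hxP : x ∈ P
    · rwa [hI P hPr hIP hxP]
    · obtain ⟨s, hs, hsr⟩ := hr P (mem_minimalPrimes_of_notMem hx hI hPr hIP hxP)
      exact absurd (hP (by rwa [Submodule.mem_colon_singleton])) hs
  obtain ⟨k, hk⟩ := this
  exact ⟨k, by rwa [Submodule.mem_colon_singleton] at hk⟩

end SymbolicPowers

/-! ### Positive depth from one regular element. -/

section Depth

variable {R : Type*} [CommRing R] [IsLocalRing R]

lemma localDepth_quotient_pos {J : Ideal R} {x : R} (hx : x ∈ maximalIdeal R) (hJ : J ≠ ⊤)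
    (h : ∀ r, x * r ∈ J → r ∈ J) : 0 < localDepth R (R ⧸ J) := by
  have : Nontrivial (R ⧸ J) := Ideal.Quotient.nontrivial_iff.mpr hJ
  have reg : RingTheory.Sequence.IsRegular (R ⧸ J) [x] := by
    refine RingTheory.Sequence.IsRegular.of_isWeaklyRegular_of_mem_maximalIdeal _ (by simpa) ?_
    rw [RingTheory.Sequence.isWeaklyRegular_singleton_iff, isSMulRegular_iff_right_eq_zero_of_smul]
    intro a ha
    obtain ⟨a, rfl⟩ := Ideal.Quotient.mk_surjective a
    rw [← Ideal.Quotient.mk_eq_mk, ← Submodule.Quotient.mk_smul,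
      Submodule.Quotient.mk_eq_zero] at ha
    exact Ideal.Quotient.eq_zero_iff_mem.mpr (h a ha)
  refine lt_of_lt_of_le zero_lt_one ?_
  exact le_iSup (fun rs : {rs : List R // RingTheory.Sequence.IsRegular (R ⧸ J) rs ∧
    ∀ r ∈ rs, r ∈ maximalIdeal R} => (rs.1.length : ℕ∞)) ⟨[x], reg, by simpa⟩

end Depth

/-! ### The third symbolic power: colon formula and length. -/

namespace TernaryForms

variable {R : Type*} [CommRing R]

/-- The situation of a `2 × 3` matrix whose first row is a system of parameters and whose second
row consists of multiples of the squares of its entries, in the order `y, z, x`. -/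
structure SquareMatrix (x y z p q : R) : Prop where
  matrix : RegularMatrix x y z p q (x ^ 2)
  powers : PowerRegular x y z
  xqp : RegTriple x q p R
  xzp : RegTriple x z p R
  sq_dvd_p : y ^ 2 ∣ p
  sq_dvd_q : z ^ 2 ∣ q
  q_dvd : ∃ n, q ∣ z ^ n

variable {x y z p q : R}

lemma mem_minors {w r : R} : r ∈ minors x y z p q w ↔
    ∃ a b c, r = a * (y * w - z * q) + b * (z * p - x * w) + c * (x * q - y * p) := by
  rw [minors, Ideal.mem_span_range_iff_exists_fun]
  constructor
  · rintro ⟨c, rfl⟩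
    exact ⟨c 0, c 1, c 2, by simp [Fin.sum_univ_three]⟩
  · rintro ⟨a, b, c, rfl⟩
    exact ⟨![a, b, c], by simp [Fin.sum_univ_three]⟩

namespace SquareMatrix

/-- Modulo `x`, the relations among the minors are generated by the reduced rows `(0, y, z)` and
`(p, q, 0)`. Both lift to relations over `R`, namely the rows of the matrix; subtracting these
leaves coefficients divisible by `x`, which is then cancelled. -/
lemma mem_minors_of_mul_mem (h : SquareMatrix x y z p q) {r : R}
    (hr : x * r ∈ minors x y z p q (x ^ 2)) : r ∈ minors x y z p q (x ^ 2) := by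
  obtain ⟨α, β, γ, e⟩ := mem_minors.mp hr
  obtain ⟨n, s, hn⟩ := h.matrix.dvd_pow
  obtain ⟨k, l, e₁⟩ := (h.powers.xzy 1 1 1 (by simp) (by simp) (by simp)).exists_eq
    (m := γ * p) (a := α * y * x - β * x ^ 2 + γ * q - r) (b := β * p - α * q) (c := 0)
    (by linear_combination e)
  obtain ⟨k', l', e₂⟩ := (h.powers.xzy 1 (n + 1) 1 (by simp) (by simp) (by simp)).exists_eq
    (m := γ) (a := y * s * k) (b := y * s * l) (c := 0)
    (by linear_combination γ * y * hn + y * s * e₁)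
  have e₃ : z * (β * p - α * q - l' * y * p) =
      x * (r - α * y * x + β * x ^ 2 - γ * q + k' * y * p) := by
    linear_combination -e + y * p * e₂
  obtain ⟨m, e₄⟩ := (h.powers.xzy 1 1 1 (by simp) (by simp) (by simp)).snd _ _
    (by simpa using e₃)
  simp only [pow_one, smul_eq_mul] at e₄
  obtain ⟨b₁, b₂, e₅⟩ := h.xqp.exists_eq (m := β - l' * y) (a := m) (b := α) (c := 0)
    (by linear_combination e₄)
  obtain ⟨a₁, e₆⟩ := h.xqp.snd (α - p * b₂) (p * b₁ - m) (by
    simp only [smul_eq_mul]; linear_combination -e₄ + p * e₅)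
  simp only [smul_eq_mul] at e₆
  have hα : α = p * b₂ + x * a₁ := by linear_combination e₆
  have hβ : β = l' * y + b₁ * x + b₂ * q := by linear_combination e₅
  have hγ : γ = k' * x + l' * z := by linear_combination e₂
  apply mem_minors.mpr
  -- This is `((α, β, γ) - l' (x, y, z) - b₂ (p, q, x²)) / x`.
  refine ⟨a₁ - l', b₁, k' - b₂ * x, ?_⟩
  rw [← sub_eq_zero]
  apply h.matrix.reg.fst
  rw [hα, hβ, hγ] at e
  rw [smul_eq_mul]
  linear_combination e

lemma notMem_of_mem_minimalPrimes (h : SquareMatrix x y z p q) {P : Ideal R}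
    (hP : P ∈ (minors x y z p q (x ^ 2)).minimalPrimes) : x ∉ P := fun hx => by
  obtain ⟨s, hs, hxs⟩ := Ideal.exists_mul_mem_of_mem_minimalPrimes hP hx
  exact hs (h.mem_minors_of_mul_mem hxs)

lemma mem_symbolicPower_of_mul_mem (h : SquareMatrix x y z p q) {n k : ℕ} {r : R}
    (hr : x ^ k * r ∈ minors x y z p q (x ^ 2) ^ n) :
    r ∈ symbolicPower (minors x y z p q (x ^ 2)) n := by
  rw [mem_symbolicPower_iff]
  intro P hP
  exact ⟨x ^ k, fun hx => h.notMem_of_mem_minimalPrimes hP (hP.1.1.mem_of_pow_mem _ hx), hr⟩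

lemma mem_symbolicPower_of_mul_mem_symbolicPower (h : SquareMatrix x y z p q) {n : ℕ} {r : R}
    (hr : x * r ∈ symbolicPower (minors x y z p q (x ^ 2)) n) :
    r ∈ symbolicPower (minors x y z p q (x ^ 2)) n := by
  rw [mem_symbolicPower_iff] at hr ⊢
  intro P hP
  obtain ⟨s, hs, hsr⟩ := hr P hP
  refine ⟨s * x, fun hsx => ?_, by rwa [mul_assoc]⟩
  exact (hP.1.1.mem_or_mem hsx).elim hs (h.notMem_of_mem_minimalPrimes hP)

section Local

variable [IsLocalRing R]

/-- Modulo `x` two of the minors become `-z q` and `-y p`. As `q` and `p` divide powers of `z` and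
`y`, a prime containing `x` and the minors contains `y` and `z`. -/
lemma eq_maximalIdeal (h : SquareMatrix x y z p q)
    (hm : maximalIdeal R ≤ (Ideal.span {x, y, z}).radical) (P : Ideal R) (hP : P.IsPrime)
    (hIP : minors x y z p q (x ^ 2) ≤ P) (hx : x ∈ P) : P = maximalIdeal R := by
  refine le_antisymm (le_maximalIdeal hP.ne_top) (hm.trans ?_)
  rw [hP.radical_le_iff, Ideal.span_le]
  have h1 : y * x ^ 2 - z * q ∈ P := hIP (mem_minors.mpr ⟨1, 0, 0, by ring⟩)
  have h3 : x * q - y * p ∈ P := hIP (mem_minors.mpr ⟨0, 0, 1, by ring⟩)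
  have hzq : z * q ∈ P := by
    convert sub_mem (P.mul_mem_left (y * x) hx) h1 using 1; ring
  have hyp : y * p ∈ P := by
    convert sub_mem (P.mul_mem_left q hx) h3 using 1; ring
  have hy : y ∈ P := by
    obtain ⟨n, s, hn⟩ := h.matrix.dvd_pow
    refine hP.mem_of_pow_mem (n + 1) ?_
    convert P.mul_mem_right s hyp using 1
    rw [pow_succ, hn]; ring
  have hz : z ∈ P := by
    obtain ⟨n, s, hn⟩ := h.q_dvd
    refine hP.mem_of_pow_mem (n + 1) ?_
    convert P.mul_mem_right s hzq using 1
    rw [pow_succ, hn]; ring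
  rintro _ (rfl | rfl | rfl) <;> assumption

/-- Quotients by symbolic powers have positive depth. -/
theorem localDepth_pos (h : SquareMatrix x y z p q)
    (hm : (Ideal.span {x, y, z}).radical = maximalIdeal R) (n : ℕ) (hn : n ≠ 0) :
    0 < localDepth R (R ⧸ symbolicPower (minors x y z p q (x ^ 2)) n) := by
  have hmem : ∀ t ∈ ({x, y, z} : Set R), t ∈ maximalIdeal R := fun t ht =>
    hm ▸ Ideal.le_radical (Ideal.subset_span ht)
  have hx := hmem x (by simp)
  have hy := hmem y (by simp)
  have hz := hmem z (by simp)
  refine localDepth_quotient_pos hx ?_ fun r => h.mem_symbolicPower_of_mul_mem_symbolicPower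
  have hI : minors x y z p q (x ^ 2) ≤ maximalIdeal R := by
    intro r hr
    obtain ⟨a, b, c, rfl⟩ := mem_minors.mp hr
    refine add_mem (add_mem ?_ ?_) ?_ <;> refine Ideal.mul_mem_left _ _ (sub_mem ?_ ?_) <;>
      refine Ideal.mul_mem_right _ _ ?_ <;> assumption
  obtain ⟨P, hP, -⟩ := Ideal.exists_minimalPrimes_le hI
  rw [Ideal.ne_top_iff_one, mem_symbolicPower_iff]
  intro H
  obtain ⟨s, hs, hs'⟩ := H P hP
  rw [mul_one] at hs'
  exact hs (hP.1.2 (Ideal.pow_le_self hn hs'))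

variable [IsNoetherianRing R]

/-- The third symbolic power as a colon ideal. -/
theorem symbolicPower_eq (h : SquareMatrix x y z p q) (h2 : IsUnit (2 : R))
    (hm : (Ideal.span {x, y, z}).radical = maximalIdeal R) :
    symbolicPower (minors x y z p q (x ^ 2)) 3 =
      (minors x y z p q (x ^ 2) ^ 3).colon ((Ideal.span {x, y, z} ^ 2 : Ideal R) : Set R) := by
  have hmem : ∀ t ∈ ({x, y, z} : Set R), t ∈ maximalIdeal R := fun t ht =>
    hm ▸ Ideal.le_radical (Ideal.subset_span ht)
  ext r
  rw [Submodule.mem_colon]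
  constructor
  · intro hr κ hκ
    have key := fun t ht => exists_pow_mul_mem_of_mem_symbolicPower (hmem x (by simp))
      (h.eq_maximalIdeal hm.ge) hr (hmem t ht)
    obtain ⟨a, ha⟩ := key x (by simp)
    obtain ⟨b, hb⟩ := key y (by simp)
    obtain ⟨c, hc⟩ := key z (by simp)
    have up : ∀ (t : R) (n : ℕ), t ^ n * r ∈ minors x y z p q (x ^ 2) ^ 3 →
        t ^ (n + 1) * r ∈ minors x y z p q (x ^ 2) ^ 3 := fun t n ht => by
      rw [pow_succ' t n, mul_assoc]; exact Ideal.mul_mem_left _ _ ht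
    -- The exponents are raised by one because `PowerRegular` requires them to be positive.
    have hreg := h.powers.xyz (a + 1) (b + 1) (c + 1) (by simp) (by simp) (by simp)
    obtain ⟨k, hk⟩ := h.matrix.exists_mem_cubeRelation_left (up _ _ ha) (up _ _ hb) (up _ _ hc)
    have hk' := (RegularMatrix.productMem_of_mem_cubeRelation hk).1
    -- The relation is linear, so `κ r` has residue `κ k`, whose entries lie in the parameter ideal;
    -- hence `κ r` is in the cube.
    have := (h.matrix.mem_cube_iff_of_mem_cubeRelation hreg (Submodule.smul_mem _ κ hk)).mpr
      fun i => hk'.mul_mem h2 i hκ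
    rwa [smul_eq_mul, mul_comm]
  · intro hr
    refine h.mem_symbolicPower_of_mul_mem (k := 2) ?_
    rw [mul_comm]
    exact hr _ (Ideal.pow_mem_pow (Ideal.subset_span (by simp)) 2)

/-- The length of the third symbolic power modulo the cube. -/
theorem length_symbolicPower (h : SquareMatrix x y z p q) (h2 : IsUnit (2 : R))
    (hm : (Ideal.span {x, y, z}).radical = maximalIdeal R) :
    Module.length R (symbolicPower (minors x y z p q (x ^ 2)) 3 ⧸
      (minors x y z p q (x ^ 2) ^ 3).submoduleOf (symbolicPower (minors x y z p q (x ^ 2)) 3)) =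
        6 * Module.length R (R ⧸ Ideal.span {x, y, z}) := by
  rw [← h.powers.length_productKernel h2]
  have hreg := h.powers.xyz 2 2 2 (by simp) (by simp) (by simp)
  refine length_eq_of_relation (cubeRelation x y z p q (x ^ 2) (x ^ 2) (y ^ 2) (z ^ 2))
    ?_ ?_ ?_ ?_
  · intro r hr
    rw [h.symbolicPower_eq h2 hm, Submodule.mem_colon] at hr
    have key : ∀ t ∈ ({x, y, z} : Set R), t ^ 2 * r ∈ minors x y z p q (x ^ 2) ^ 3 := by
      intro t ht
      rw [mul_comm]
      exact hr _ (Ideal.pow_mem_pow (Ideal.subset_span ht) 2)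
    exact h.matrix.exists_mem_cubeRelation_left (key x (by simp)) (key y (by simp))
      (key z (by simp))
  -- The second row consists of elements of `(x², y², z²)`, so the condition coming from `g` is
  -- automatic.
  · intro k hk
    refine h.matrix.exists_mem_cubeRelation_right hreg hk ?_
    have hx : x ^ 2 ∈ Ideal.span {x ^ 2, y ^ 2, z ^ 2} := Ideal.subset_span (by simp)
    have hp : p ∈ Ideal.span {x ^ 2, y ^ 2, z ^ 2} :=
      Ideal.mem_of_dvd _ h.sq_dvd_p (Ideal.subset_span (by simp))
    have hq : q ∈ Ideal.span {x ^ 2, y ^ 2, z ^ 2} :=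
      Ideal.mem_of_dvd _ h.sq_dvd_q (Ideal.subset_span (by simp))
    have m : ∀ {a : R} (b : R), a ∈ Ideal.span {x ^ 2, y ^ 2, z ^ 2} →
      a * b ∈ Ideal.span {x ^ 2, y ^ 2, z ^ 2} := fun b ha => Ideal.mul_mem_right b _ ha
    exact ⟨m _ hp, add_mem (m _ hq) (m _ hp), add_mem (m _ hx) (m _ hp), m _ hq,
      add_mem (m _ hx) (m _ hq), m _ hx⟩
  · intro r k hk
    exact ⟨h.mem_symbolicPower_of_mul_mem (RegularMatrix.mul_mem_of_mem_cubeRelation hk).1,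
      (RegularMatrix.productMem_of_mem_cubeRelation hk).1⟩
  · intro r k hk
    rw [mem_entriesIn]
    exact h.matrix.mem_cube_iff_of_mem_cubeRelation hreg hk

end Local

end SquareMatrix

end TernaryForms

/-! ### The explicit identities and the free basis containing `v²`. -/

namespace StarTransform

section Identities

variable {R : Type*} [CommRing R]

lemma phi13_eq_sum {x y z : R} {β γ β' γ' : ℕ} (hβ : β ≤ β') (hγ : γ ≤ γ') (M : Fin 3) :
    phi13 x y z β γ β' γ' M =
      ∑ j : Fin 3, (![x, y ^ β, z ^ γ] j) • v1 x y z β γ β' γ' (j, M) := by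
  have hy : y ^ β' = y ^ β * y ^ (β' - β) := by rw [← pow_add, Nat.add_sub_cancel' hβ]
  have hz : z ^ γ' = z ^ γ * z ^ (γ' - γ) := by rw [← pow_add, Nat.add_sub_cancel' hγ]
  simp only [phi13, v1, Fin.sum_univ_three, hy, hz, Matrix.cons_val_zero, Matrix.cons_val_one,
    Matrix.cons_val]
  module

lemma phi3_single (ξ : Fin 3 → R) {Λ F₂ : Type*} [Fintype Λ] [DecidableEq Λ] [AddCommGroup F₂]
    [Module R F₂] (v : Fin 3 × Λ → F₂) (p : Fin 3 × Λ) :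
    phi3 ξ v (Pi.single p 1) =
      (ξ (p.1.succAbove 0) • Pi.single (p.1.succAbove 1, p.2) 1 -
        ξ (p.1.succAbove 1) • Pi.single (p.1.succAbove 0, p.2) 1, (-1 : R) ^ (p.1.val + 1) • v p) := by
  rw [phi3, Fintype.linearCombination_apply_single, one_smul]
  simp only [← Pi.single_smul, smul_eq_mul, mul_one]

lemma phi3_w2 {x y z : R} {β γ β' γ' : ℕ} (hβ : 2 * β ≤ β') (hγ : 2 * γ ≤ γ') (l : Fin 3) :
    phi3 ![x, y ^ β, z ^ γ] (v1 x y z β γ β' γ') (w2 R l) =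
      ((∑ j : Fin 3, (![x, y ^ β, z ^ γ] j) • v2 y z β γ β' γ' (j, l) : F22 R) :
        (Fin 3 × Fin 3 → R) × (S2 R × S2 R)) := by
  have hy : y ^ (β' - β) = y ^ β * y ^ (β' - 2 * β) := by rw [← pow_add]; congr 1; omega
  have hz : z ^ (γ' - γ) = z ^ γ * z ^ (γ' - 2 * γ) := by rw [← pow_add]; congr 1; omega
  have s00 : (0 : Fin 3).succAbove (0 : Fin 2) = 1 := rfl
  have s01 : (0 : Fin 3).succAbove (1 : Fin 2) = 2 := rfl
  have s10 : (1 : Fin 3).succAbove (0 : Fin 2) = 0 := rfl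
  have s11 : (1 : Fin 3).succAbove (1 : Fin 2) = 2 := rfl
  have s20 : (2 : Fin 3).succAbove (0 : Fin 2) = 0 := rfl
  have s21 : (2 : Fin 3).succAbove (1 : Fin 2) = 1 := rfl
  have c10 : s((1 : Fin 3), 0) = s(0, 1) := Sym2.eq_swap
  have c20 : s((2 : Fin 3), 0) = s(0, 2) := Sym2.eq_swap
  have c21 : s((2 : Fin 3), 1) = s(1, 2) := Sym2.eq_swap
  fin_cases l <;>
  simp only [w2, Fin.zero_eta, Fin.mk_one, Fin.reduceFinMk, map_add, map_sub, map_neg, phi3_single,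
    s00, s01, s10, s11, s20, s21, v1, v2, br, abr, hy, hz, Fin.sum_univ_three, c10, c20, c21,
    Matrix.cons_val_zero, Matrix.cons_val_one, Matrix.cons_val, Submodule.coe_add,
    Submodule.coe_smul, Submodule.coe_neg, Submodule.coe_sub, Fin.val_zero, Fin.val_one, Fin.val_two]
  · refine Prod.ext ?_ ?_
    · simp; module
    · simp; module
  · refine Prod.ext ?_ ?_
    · simp; module
    · simp; module
  · refine Prod.ext ?_ ?_
    · simp; module
    · simp; module

end Identities

section Basis

variable (R : Type*) [CommRing R]

/-- The coordinates of `F²₂`. -/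
def toF22 : ((Fin 3 × Fin 3 → R) × S2 R) →ₗ[R] F22 R where
  toFun t := ⟨(t.1, (t.2, 0)), by
    have h : ((t.1, (t.2, 0)) : (Fin 3 × Fin 3 → R) × (S2 R × S2 R)) =
        ∑ p, t.1 p • ((br R p.1 p.2 : F22 R) : (Fin 3 × Fin 3 → R) × (S2 R × S2 R)) +
        ∑ N, t.2 N • ((abr R N : F22 R) : (Fin 3 × Fin 3 → R) × (S2 R × S2 R)) := by
      have e1 : ∀ t : (Fin 3 × Fin 3 → R), ∑ p, t p • Pi.single p (1 : R) = t := fun t => by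
        simpa using (Pi.basisFun R (Fin 3 × Fin 3)).sum_repr t
      have e2 : ∀ t : S2 R, ∑ p, t p • Pi.single p (1 : R) = t := fun t => by
        simpa using (Pi.basisFun R (Sym2 (Fin 3))).sum_repr t
      refine Prod.ext ?_ (Prod.ext ?_ ?_)
      · simpa [br, abr, Prod.fst_sum] using (e1 t.1).symm
      · simpa [br, abr, Prod.snd_sum, Prod.fst_sum, sq] using (e2 t.2).symm
      · simp [br, abr, Prod.snd_sum, sq]
    rw [h]
    exact add_mem (sum_mem fun p _ => Submodule.smul_mem _ _ (br R p.1 p.2).2)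
      (sum_mem fun N _ => Submodule.smul_mem _ _ (abr R N).2)⟩
  map_add' s t := Subtype.ext (by simp)
  map_smul' r t := Subtype.ext (by simp)

lemma toF22_bijective : Function.Bijective (toF22 R) := by
  constructor
  · rintro ⟨a, b⟩ ⟨a', b'⟩ h
    have := congrArg Subtype.val h
    simp only [toF22, LinearMap.coe_mk, AddHom.coe_mk, Prod.mk.injEq] at this
    exact Prod.ext this.1 this.2.1
  · rintro ⟨⟨a, b, c⟩, h⟩
    have hc : c = 0 := by
      -- All generators have zero component in the second copy of `S₂`.
      have hle : starF2 (Fin 3) (Set.range (sq R)) ≤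
          LinearMap.ker (LinearMap.snd R (S2 R) (S2 R) ∘ₗ LinearMap.snd R (Fin 3 × Fin 3 → R) _) := by
        rw [starF2, Submodule.span_le]
        rintro _ (⟨p, rfl⟩ | ⟨_, ⟨N, rfl⟩, rfl⟩) <;> simp [sq]
      simpa using hle h
    exact ⟨(a, b), Subtype.ext (by simp [toF22, hc])⟩

/-- The basis of `F²₂` consisting of the elements `[i, M]` and `⟨[N]⟩`. -/
noncomputable def basisF22 : Module.Basis ((Fin 3 × Fin 3) ⊕ Sym2 (Fin 3)) R (F22 R) :=
  ((Pi.basisFun R (Fin 3 × Fin 3)).prod (Pi.basisFun R (Sym2 (Fin 3)))).map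
    (LinearEquiv.ofBijective (toF22 R) (toF22_bijective R))

lemma basisF22_inl (p : Fin 3 × Fin 3) : basisF22 R (Sum.inl p) = br R p.1 p.2 := by
  apply Subtype.ext
  simp [basisF22, toF22, br]

lemma basisF22_inr (N : Sym2 (Fin 3)) : basisF22 R (Sum.inr N) = abr R N := by
  apply Subtype.ext
  simp [basisF22, toF22, abr, sq]

variable {R}

/-- Modulo the `⟨[N]⟩`, six of the `v²` are, up to sign, the six `[i, M]` off the diagonal. The
other three are, up to sign, the pairwise sums of the diagonal ones, and this system has determinant
`2` up to sign. -/
lemma br_mem_of_v2_mem (h2 : IsUnit (2 : R)) {y z : R} {β γ β' γ' : ℕ} (L : Submodule R (F22 R))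
    (hv : ∀ p, v2 y z β γ β' γ' p ∈ L) (hN : ∀ N, abr R N ∈ L) (i M : Fin 3) : br R i M ∈ L := by
  obtain ⟨c, hc⟩ := h2.exists_left_inv
  have half : ∀ a b : F22 R, (2 : R) • a = b → b ∈ L → a ∈ L := fun a b h hb => by
    have := L.smul_mem c hb
    rwa [← h, smul_smul, hc, one_smul] at this
  have k := fun (r : R) N => L.smul_mem r (hN N)
  have h00 := hv (0, 0)
  have h10 := hv (1, 0)
  have h20 := hv (2, 0)
  have h01 := hv (0, 1)
  have h11 := hv (1, 1)
  have h21 := hv (2, 1)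
  have h02 := hv (0, 2)
  have h12 := hv (1, 2)
  have h22 := hv (2, 2)
  simp only [v2] at h00 h10 h20 h01 h11 h21 h02 h12 h22
  have b20 : br R 2 0 ∈ L := by
    convert sub_mem (neg_mem h00) (hN s(1, 2)) using 1; abel
  have b21 : br R 2 1 ∈ L := by
    convert sub_mem (k (y ^ (β' - 2 * β)) s(0, 0)) h10 using 1; abel
  have b10 : br R 1 0 ∈ L := by
    convert add_mem h01 (hN s(2, 2)) using 1; abel
  have b12 : br R 1 2 ∈ L := by
    convert sub_mem h21 (k (z ^ (γ' - 2 * γ)) s(0, 1)) using 1; abel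
  have b01 : br R 0 1 ∈ L := by
    convert sub_mem (neg_mem h12) (k (y ^ (β' - 2 * β)) s(0, 2)) using 1; abel
  have b02 : br R 0 2 ∈ L := by
    convert sub_mem (k (z ^ (γ' - 2 * γ)) s(1, 1)) h22 using 1; abel
  have b11 : br R 1 1 ∈ L := by
    -- `([2,B] + [1,A]) + (-[3,C] - [1,A]) + ([3,C] + [2,B]) = 2 [2,B]`.
    refine half _ _ ?_ (add_mem (add_mem h20 h11) h02)
    module
  have b00 : br R 0 0 ∈ L := by
    convert sub_mem h20 b11 using 1; abel
  have b22 : br R 2 2 ∈ L := by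
    convert sub_mem h02 b11 using 1; abel
  fin_cases i <;> fin_cases M <;> assumption

/-- The family `v²` is part of a free basis of `F²₂`. -/
theorem admissible_v2 [Nontrivial R] (h2 : IsUnit (2 : R)) (y z : R) (β γ β' γ' : ℕ) :
    Admissible (R := R) (v2 y z β γ β' γ') Set.univ := by
  set F : F22 R →ₗ[R] F22 R :=
    (basisF22 R).constr R (Sum.elim (v2 y z β γ β' γ') (abr R)) with hF
  have Finl : ∀ p, F (basisF22 R (Sum.inl p)) = v2 y z β γ β' γ' p := fun p => by
    rw [hF, Module.Basis.constr_basis, Sum.elim_inl]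
  have Finr : ∀ N, F (basisF22 R (Sum.inr N)) = abr R N := fun N => by
    rw [hF, Module.Basis.constr_basis, Sum.elim_inr]
  have hN : ∀ N, abr R N ∈ LinearMap.range F := fun N => ⟨_, Finr N⟩
  have surj : Function.Surjective F := by
    rw [← LinearMap.range_eq_top, eq_top_iff, ← (basisF22 R).span_eq, Submodule.span_le]
    rintro _ ⟨p | N, rfl⟩
    · rw [basisF22_inl]
      exact br_mem_of_v2_mem h2 (LinearMap.range F) (fun p => ⟨_, Finl p⟩) hN _ _
    · rw [basisF22_inr]
      exact hN N
  have : Module.Finite R (F22 R) := Module.Finite.of_basis (basisF22 R)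
  -- A surjective endomorphism of a finitely generated module is injective, so generation alone
  -- yields a basis.
  have bij : Function.Bijective F :=
    ⟨OrzechProperty.injective_of_surjective_endomorphism F surj, surj⟩
  have inj : Function.Injective (abr R) := by
    intro N N' h
    rw [← basisF22_inr, ← basisF22_inr] at h
    exact Sum.inr_injective ((basisF22 R).injective h)
  refine ⟨Set.range (abr R), ((basisF22 R).map (LinearEquiv.ofBijective F bij)).reindex
    (Equiv.sumCongr (Equiv.Set.univ _).symm (Equiv.ofInjective _ inj)), ?_, ?_⟩
  · rintro ⟨p, hp⟩
    rw [Module.Basis.reindex_apply, Module.Basis.map_apply]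
    exact Finl p
  · rintro ⟨_, N, rfl⟩
    rw [Module.Basis.reindex_apply, Module.Basis.map_apply]
    have : (Equiv.ofInjective _ inj).symm ⟨abr R N, ⟨N, rfl⟩⟩ = N :=
      Equiv.ofInjective_symm_apply inj N
    simp only [Equiv.sumCongr_symm, Equiv.sumCongr_apply, Sum.map_inr, this]
    exact Finr N

end Basis

end StarTransform

/-! ### Verification of the hypotheses for the given matrix. -/

namespace TernaryForms

variable {R : Type*} [CommRing R]

lemma maximalMinorsIdeal_eq (x y z p q w : R) :
    maximalMinorsIdeal !![x, y, z; p, q, w] = minors x y z p q w := by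
  have m0 : y * w - z * q ∈ minors x y z p q w := mem_minors.mpr ⟨1, 0, 0, by ring⟩
  have m1 : z * p - x * w ∈ minors x y z p q w := mem_minors.mpr ⟨0, 1, 0, by ring⟩
  have m2 : x * q - y * p ∈ minors x y z p q w := mem_minors.mpr ⟨0, 0, 1, by ring⟩
  apply le_antisymm
  · rw [maximalMinorsIdeal, Ideal.span_le]
    rintro _ ⟨e, rfl⟩
    have h : e 0 < e 1 := e.strictMono (by decide)
    simp only [Matrix.det_fin_two, Matrix.submatrix_apply, id_eq]
    generalize e 0 = i, e 1 = j at h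
    fin_cases i <;> fin_cases j <;> try exact absurd h (by decide)
    · convert m2 using 1; simp
    · convert neg_mem m1 using 1; simp
    · convert m0 using 1; simp
  · have mem : ∀ v : Fin 2 → Fin 3, StrictMono v →
        (!![x, y, z; p, q, w].submatrix id v).det ∈ maximalMinorsIdeal !![x, y, z; p, q, w] :=
      fun v hv => Ideal.subset_span ⟨OrderEmbedding.ofStrictMono v hv, rfl⟩
    rw [minors, Ideal.span_le]
    rintro _ ⟨i, rfl⟩
    fin_cases i
    · simpa [Matrix.det_fin_two] using mem ![1, 2] (by decide)
    · have := neg_mem (mem ![0, 2] (by decide))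
      simpa [Matrix.det_fin_two] using this
    · simpa [Matrix.det_fin_two] using mem ![0, 1] (by decide)

/-- Powers of a system of parameters in a Cohen-Macaulay local ring of dimension three. -/
lemma squareMatrix_of_isCohenMacaulayLocal [IsLocalRing R] (hCM : IsCohenMacaulayLocal R)
    (hdim : ringKrullDim R = 3) {x y z : R} (hm : (Ideal.span {x, y, z}).radical = maximalIdeal R)
    {β γ β' γ' : ℕ} (hβ : 0 < β) (hγ : 0 < γ) (hββ' : 2 * β ≤ β') (hγγ' : 2 * γ ≤ γ') :
    SquareMatrix x (y ^ β) (z ^ γ) (y ^ β') (z ^ γ') := by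
  have hmem : ∀ t ∈ ({x, y, z} : Set R), t ∈ maximalIdeal R := fun t ht =>
    hm ▸ Ideal.le_radical (Ideal.subset_span ht)
  have hx := hmem x (by simp)
  have hy := hmem y (by simp)
  have hz := hmem z (by simp)
  have pow_mem : ∀ {t : R} {n : ℕ}, t ∈ maximalIdeal R → 0 < n → t ^ n ∈ maximalIdeal R :=
    fun ht hn => Ideal.pow_mem_of_mem _ ht _ hn
  have reg : ∀ {u v w : R}, u ∈ maximalIdeal R → v ∈ maximalIdeal R → w ∈ maximalIdeal R →
      x ∈ (Ideal.span {u, v, w}).radical → y ∈ (Ideal.span {u, v, w}).radical →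
      z ∈ (Ideal.span {u, v, w}).radical → RegTriple u v w R := by
    intro u v w hu hv hw h1 h2 h3
    refine regTriple_of_maximalIdeal_le_radical hCM hdim hu hv hw ?_
    rw [← hm, Ideal.radical_le_radical_iff, Ideal.span_le]
    rintro _ (rfl | rfl | rfl) <;> assumption
  have xyz : ∀ a b c : ℕ, 0 < a → 0 < b → 0 < c → RegTriple (x ^ a) (y ^ b) (z ^ c) R :=
    fun a b c ha hb hc => reg (pow_mem hx ha) (pow_mem hy hb) (pow_mem hz hc)
      ⟨a, Ideal.subset_span (by simp)⟩ ⟨b, Ideal.subset_span (by simp)⟩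
      ⟨c, Ideal.subset_span (by simp)⟩
  have xzy : ∀ a b c : ℕ, 0 < a → 0 < b → 0 < c → RegTriple (x ^ a) (z ^ c) (y ^ b) R :=
    fun a b c ha hb hc => reg (pow_mem hx ha) (pow_mem hz hc) (pow_mem hy hb)
      ⟨a, Ideal.subset_span (by simp)⟩ ⟨b, Ideal.subset_span (by simp)⟩
      ⟨c, Ideal.subset_span (by simp)⟩
  have yzx : ∀ a b c : ℕ, 0 < a → 0 < b → 0 < c → RegTriple (y ^ b) (z ^ c) (x ^ a) R :=
    fun a b c ha hb hc => reg (pow_mem hy hb) (pow_mem hz hc) (pow_mem hx ha)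
      ⟨a, Ideal.subset_span (by simp)⟩ ⟨b, Ideal.subset_span (by simp)⟩
      ⟨c, Ideal.subset_span (by simp)⟩
  have hβ' : 0 < β' := by omega
  have hγ' : 0 < γ' := by omega
  refine ⟨⟨?_, ⟨β', ?_⟩, ?_⟩, ⟨?_, ?_, ?_⟩, ?_, ?_, ?_, ?_, ⟨γ', ?_⟩⟩
  · simpa using xyz 1 β γ one_pos hβ hγ
  · rw [← pow_mul]
    exact pow_dvd_pow y (Nat.le_mul_of_pos_left _ hβ)
  -- Modulo `z ^ γ` the two minors become `-y ^ (β + β')` and `-x ^ 3`, so with `z ^ γ` they again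
  -- form a system of parameters.
  · set J := Ideal.span {x * z ^ γ' - y ^ β * y ^ β', z ^ γ * y ^ β' - x * x ^ 2, z ^ γ} with hJ
    have j1 : x * z ^ γ' - y ^ β * y ^ β' ∈ J := Ideal.subset_span (by simp)
    have j2 : z ^ γ * y ^ β' - x * x ^ 2 ∈ J := Ideal.subset_span (by simp)
    have j3 : z ^ γ ∈ J := Ideal.subset_span (by simp)
    refine reg ?_ ?_ (pow_mem hz hγ) ⟨3, ?_⟩ ⟨β + β', ?_⟩ ⟨γ, j3⟩
    · exact sub_mem (Ideal.mul_mem_right _ _ hx) (Ideal.mul_mem_right _ _ (pow_mem hy hβ))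
    · exact sub_mem (Ideal.mul_mem_right _ _ (pow_mem hz hγ)) (Ideal.mul_mem_right _ _ hx)
    · rw [← hJ]
      convert sub_mem (J.mul_mem_right (y ^ β') j3) j2 using 1; ring
    · rw [← hJ]
      have : z ^ γ' = z ^ γ * z ^ (γ' - γ) := by rw [← pow_add]; congr 1; omega
      convert sub_mem (J.mul_mem_right (x * z ^ (γ' - γ)) j3) j1 using 1
      rw [pow_add, this]; ring
  · intro a b c ha hb hc
    rw [← pow_mul, ← pow_mul]
    exact xyz a _ _ ha (Nat.mul_pos hβ hb) (Nat.mul_pos hγ hc)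
  · intro a b c ha hb hc
    rw [← pow_mul, ← pow_mul]
    exact xzy a _ _ ha (Nat.mul_pos hβ hb) (Nat.mul_pos hγ hc)
  · intro a b c ha hb hc
    rw [← pow_mul, ← pow_mul]
    exact yzx a _ _ ha (Nat.mul_pos hβ hb) (Nat.mul_pos hγ hc)
  · simpa using xzy 1 β' γ' one_pos hβ' hγ'
  · simpa using xzy 1 β' γ one_pos hβ' hγ
  · rw [← pow_mul]
    exact pow_dvd_pow y (by omega)
  · rw [← pow_mul]
    exact pow_dvd_pow z (by omega)
  · rw [← pow_mul]
    exact pow_dvd_pow z (Nat.le_mul_of_pos_left _ hγ)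

lemma maximalIdeal_eq_radical_span_pow [IsLocalRing R] {x y z : R}
    (hm : (Ideal.span {x, y, z}).radical = maximalIdeal R) {β γ : ℕ} (hβ : 0 < β) (hγ : 0 < γ) :
    (Ideal.span {x, y ^ β, z ^ γ}).radical = maximalIdeal R := by
  rw [← hm]
  apply le_antisymm
  · refine Ideal.radical_mono (Ideal.span_le.mpr ?_)
    rintro _ (rfl | rfl | rfl)
    · exact Ideal.subset_span (by simp)
    · exact Ideal.pow_mem_of_mem _ (Ideal.subset_span (by simp)) _ hβ
    · exact Ideal.pow_mem_of_mem _ (Ideal.subset_span (by simp)) _ hγ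
  · rw [Ideal.radical_le_radical_iff, Ideal.span_le]
    rintro _ (rfl | rfl | rfl)
    · exact ⟨1, Ideal.subset_span (by simp)⟩
    · exact ⟨β, Ideal.subset_span (by simp)⟩
    · exact ⟨γ, Ideal.subset_span (by simp)⟩

end TernaryForms

theorem theorem4p10 {R : Type*} [CommRing R] [IsLocalRing R]
    (hCM : IsCohenMacaulayLocal R) (hdim : ringKrullDim R = 3)
    (x y z : R) (hsop : IsSystemOfParameters ![x, y, z])
    (α β γ α' β' γ' : ℕ) (hβ : 0 < β) (hγ : 0 < γ) (hβ' : 0 < β') (hγ' : 0 < γ')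
    (hα : α = 1) (hα' : α' = 2) (hββ' : 2 * β ≤ β') (hγγ' : 2 * γ ≤ γ')
    (h2 : IsUnit (2 : R))
    (I Q : Ideal R)
    (hI : I = maximalMinorsIdeal !![x ^ α, y ^ β, z ^ γ; y ^ β', z ^ γ', x ^ α'])
    (hQ : Q = Ideal.span {x ^ min α α', y ^ min β β', z ^ min γ γ'}) :
    ((∀ M : Fin 3, StarTransform.phi13 x y z β γ β' γ' M =
        ∑ j : Fin 3, (![x, y ^ β, z ^ γ] j) • StarTransform.v1 x y z β γ β' γ' (j, M)) ∧
      (∀ l : Fin 3,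
        StarTransform.phi3 ![x, y ^ β, z ^ γ] (StarTransform.v1 x y z β γ β' γ')
            (StarTransform.w2 R l) =
          ((∑ j : Fin 3, (![x, y ^ β, z ^ γ] j) • StarTransform.v2 y z β γ β' γ' (j, l) :
            StarTransform.F22 R) :
            (Fin 3 × Fin 3 → R) × (StarTransform.S2 R × StarTransform.S2 R))) ∧
      StarTransform.Admissible (R := R) (StarTransform.v2 y z β γ β' γ') Set.univ) ∧
    0 < localDepth R (R ⧸ (I ^ 3).colon ((Q ^ 2 : Ideal R) : Set R)) ∧
    symbolicPower I 3 = (I ^ 3).colon ((Q ^ 2 : Ideal R) : Set R) ∧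
    Module.length R (symbolicPower I 3 ⧸ (I ^ 3).submoduleOf (symbolicPower I 3)) =
      6 * Module.length R (R ⧸ Q) := by
  subst hα hα'
  have hrad : (Ideal.span {x, y, z}).radical = maximalIdeal R := by
    have h := hsop.2
    simp only [Matrix.range_cons, Matrix.range_empty, Set.union_empty, Set.singleton_union] at h
    exact h
  have hm := TernaryForms.maximalIdeal_eq_radical_span_pow hrad hβ hγ
  have hS := TernaryForms.squareMatrix_of_isCohenMacaulayLocal hCM hdim hrad hβ hγ hββ' hγγ'
  have hN : IsNoetherianRing R := hCM.1
  have hI' : I = TernaryForms.minors x (y ^ β) (z ^ γ) (y ^ β') (z ^ γ') (x ^ 2) := by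
    rw [hI, TernaryForms.maximalMinorsIdeal_eq, pow_one]
  have hQ' : Q = Ideal.span {x, y ^ β, z ^ γ} := by
    rw [hQ, min_eq_left (by norm_num), min_eq_left (by omega), min_eq_left (by omega), pow_one]
  have hsym := hS.symbolicPower_eq h2 hm
  rw [← hI', ← hQ'] at hsym
  refine ⟨⟨fun M => StarTransform.phi13_eq_sum (by omega) (by omega) M,
    fun l => StarTransform.phi3_w2 hββ' hγγ' l,
    StarTransform.admissible_v2 h2 y z β γ β' γ'⟩, ?_, hsym, ?_⟩
  · rw [← hsym, hI']
    exact hS.localDepth_pos hm 3 (by norm_num)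
  · rw [hI', hQ']
    exact hS.length_symbolicPower h2 hm
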